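/- For a weakly increasing sequence of positive integers $\lambda = (\lambda_1 \le \dots \le \lambda_n)$, the Gelfand–Tsetlin polytope $\mathrm{GT}_\lambda$ is the set of all real arrays $(x_{i,j})_{1 \le j \le i \le n}$ with $x_{i,i} = \lambda_i$ for all $i$, and with $x_{i,j} \le x_{i+1,j}$ and $x_{i,j} \le x_{i,j+1}$ whenever both entries belong to the array. A combinatorial automorphism of a polytope is an automorphism of the poset of its faces ordered by inclusion; these form the group $\mathrm{Aut}(\mathrm{GT}_\lambda)$ under composition. **Theorem.** Let $a_1, a_2 \ge 2$ be integers and let $\lambda = (1^{a_1}, 2^{a_2})$ be the sequence consisting of $a_1$ ones followed by $a_2$ twos. If $a_1 = a_2 = 2$, then $$\mathrm{Aut}(\mathrm{GT}_\lambda) \cong D_4 \times \mathbb{Z}_2.$$ Otherwise, $$\mathrm{Aut}(\mathrm{GT}_\lambda) \cong D_4 \times \mathbb{Z}_2 \times \mathbb{Z}_2^{\delta_{a_1,a_2}}.$$ Here $D_4$ is the dihedral group of order $8$, $\mathbb{Z}_2$ is the cyclic group of order $2$, and $\delta_{a_1,a_2}$ is $1$ if $a_1 = a_2$ and $0$ otherwise.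 -/

import Mathlib

/-- The triangular grid `{(i, j) : j ≤ i}` with rows and columns indexed by `Fin n`
(so the index `k : Fin n` stands for `k + 1 ∈ {1, …, n}`). -/
abbrev TriIdx (n : ℕ) : Type := {p : Fin n × Fin n // p.2 ≤ p.1}

namespace TriIdx

/-- The row index `i` of `(i, j)`. -/
def row {n : ℕ} (p : TriIdx n) : Fin n := p.1.1

/-- The column index `j` of `(i, j)`. -/
def col {n : ℕ} (p : TriIdx n) : Fin n := p.1.2

/-- The diagonal position `(i, i)`. -/
def diag {n : ℕ} (i : Fin n) : TriIdx n := ⟨(i, i), le_refl i⟩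

end TriIdx

/-- The Gelfand-Tsetlin polytope of `lam = (lam_1, …, lam_n)`: all real fillings `x` of the
triangular grid with `x_{i,i} = lam_i`, `x_{i,j} ≤ x_{i+1,j}` and `x_{i,j} ≤ x_{i,j+1}`
whenever both positions lie in the grid. -/
def GTPolytope {n : ℕ} (lam : Fin n → ℕ) : Set (TriIdx n → ℝ) :=
  {x | (∀ i : Fin n, x (TriIdx.diag i) = (lam i : ℝ)) ∧
    (∀ p q : TriIdx n, (q.row : ℕ) = p.row + 1 → q.col = p.col → x p ≤ x q) ∧
    (∀ p q : TriIdx n, q.row = p.row → (q.col : ℕ) = p.col + 1 → x p ≤ x q)}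

/-- The partition `(1^{a₁}, 2^{a₂})`, written as a weakly increasing sequence. -/
def twoPartPartition (a₁ a₂ : ℕ) : Fin (a₁ + a₂) → ℕ :=
  fun i => if (i : ℕ) < a₁ then 1 else 2

/-- The nonempty faces of a convex set `P`: the sets of maximizers over `P` of linear
functionals (the zero functional gives `P` itself). They are ordered by inclusion.
The empty face is left out; adding it as a new least element would not change the
automorphism group of this poset. -/
abbrev PolytopeFace {E : Type*} [AddCommGroup E] [Module ℝ E] [TopologicalSpace E]
    (P : Set E) : Type _ :=
  {F : Set E // F.Nonempty ∧ IsExposed ℝ P F}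

/-- The combinatorial automorphism group of `P`: the order automorphisms of its face poset,
with composition as multiplication. -/
abbrev CombAut {E : Type*} [AddCommGroup E] [Module ℝ E] [TopologicalSpace E]
    (P : Set E) : Type _ :=
  PolytopeFace P ≃o PolytopeFace P

/-! ### Faces of polyhedra -/

section Faces

open Set

variable {E E' ι : Type*} [AddCommGroup E] [Module ℝ E] [TopologicalSpace E]
  [AddCommGroup E'] [Module ℝ E'] [TopologicalSpace E'] [IsTopologicalAddGroup E']
  [ContinuousSMul ℝ E'] [T2Space E'] [FiniteDimensional ℝ E']

/-! Put `m = a₁ - 1` and `n = a₂ - 1`. The entries not forced to be `1` or `2` form a grid of `m ×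
n` unit squares; after subtracting `1`, the polytope is the order polytope of a product of two
chains, with `x (i, k)` increasing in `i` and decreasing in `k`. Its facets are the edges of the
Hasse diagram with a least and a greatest element adjoined: the grid edges, together with `bot`
(minimum at least `0`) and `top` (maximum at most `1`).

A nonempty face is determined by the facets containing it (`IsExposed.eq_tightFace`), so an
automorphism is determined by its permutation of the edges (`facetHom_injective`). That permutation
preserves the relation "the facets of `e` and `f` meet inside the facet of `g`". Testing on
staircase indicators shows that the only nontrivial instances come from unit squares: two sides
forming one of the two maximal chains of a square force the other two sides (`tightImp_grid_iff`).

This square structure is rigid. The pair of edges at the corner `(0, 0)` must go to itself or to the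
pair at `(m, n)`. Once the four edges of the first square are fixed, everything is fixed level by
level, except for possible exchanges of the last pair and of `bot` and `top`. If the first pair is
fixed but the opposite sides of the first square are exchanged, then `m = n`. Hence the apex
exchange, the half turn, the corner exchange and, for `m = n`, the transposition generate everything
(`mem_of_respectsSquares`), and each is induced by an affine symmetry.

The two corner exchanges and the half turn that swaps them generate `D₄`; the apex exchange
contributes a commuting factor of order two. So does the transposition when `m = n ≥ 2`, whereas for
`m = n = 1` it is already the product of the corner and apex exchanges. -/

theorem IsExposed.image_of_affine_inverse {P F : Set E} {P' : Set E'} (f : E → E')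
    (g : E' →ᵃ[ℝ] E) (hf : MapsTo f P P') (hg : MapsTo g P' P)
    (hgf : ∀ x ∈ P, g (f x) = x) (hfg : ∀ y ∈ P', f (g y) = y) (hF : IsExposed ℝ P F) :
    IsExposed ℝ P' (f '' F) := by
  intro hne
  obtain ⟨l, hl⟩ := hF hne.of_image
  have key : ∀ z, l (g z) = l (g.linear z) + l (g 0) := fun z => by
    rw [← map_add]
    congr 1
    simpa using g.map_vadd 0 z
  -- On `P'` this functional differs from `l ∘ g` only by the constant `l (g 0)`, so the maximizers
  -- agree.
  refine ⟨LinearMap.toContinuousLinearMap (l.toLinearMap ∘ₗ g.linear), ?_⟩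
  subst hl
  ext y
  simp only [mem_image, mem_ofPred_eq, LinearMap.coe_toContinuousLinearMap', LinearMap.comp_apply,
    ContinuousLinearMap.coe_coe]
  constructor
  · rintro ⟨x, ⟨hx, hmax⟩, rfl⟩
    refine ⟨hf hx, fun z hz => ?_⟩
    have h1 := hmax _ (hg hz)
    have h2 := key (f x)
    rw [hgf x hx] at h2
    rw [h2, key z] at h1
    linarith
  · rintro ⟨hy, hmax⟩
    refine ⟨g y, ⟨hg hy, fun z hz => ?_⟩, hfg y hy⟩
    have h1 := hmax _ (hf hz)
    have h2 := key (f z)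
    rw [hgf z hz] at h2
    rw [h2, key y]
    linarith

variable [IsTopologicalAddGroup E] [ContinuousSMul ℝ E] [T2Space E] [FiniteDimensional ℝ E]

/-- Mutually inverse affine maps between two convex sets identify their face posets. -/
def faceIso {P : Set E} {P' : Set E'} (f : E →ᵃ[ℝ] E') (g : E' →ᵃ[ℝ] E) (hf : MapsTo f P P')
    (hg : MapsTo g P' P) (hgf : ∀ x ∈ P, g (f x) = x) (hfg : ∀ y ∈ P', f (g y) = y) :
    PolytopeFace P ≃o PolytopeFace P' where
  toFun F := ⟨f '' F.1, F.2.1.image f, F.2.2.image_of_affine_inverse f g hf hg hgf hfg⟩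
  invFun F := ⟨g '' F.1, F.2.1.image g, F.2.2.image_of_affine_inverse g f hg hf hfg hgf⟩
  left_inv F := by
    apply Subtype.ext
    change g '' (f '' F.1) = F.1
    rw [image_image]
    exact (image_congr fun x hx => hgf x (F.2.2.subset hx)).trans (image_id' _)
  right_inv F := by
    apply Subtype.ext
    change f '' (g '' F.1) = F.1
    rw [image_image]
    exact (image_congr fun x hx => hfg x (F.2.2.subset hx)).trans (image_id' _)
  map_rel_iff' {F G} := by
    refine ⟨fun h x hx => ?_, fun h => image_mono h⟩
    obtain ⟨y, hy, hxy⟩ := h (mem_image_of_mem f hx)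
    have h1 := congrArg g hxy
    rw [hgf _ (F.2.2.subset hx), hgf _ (G.2.2.subset hy)] at h1
    exact h1 ▸ hy

/-- The polyhedron cut out by the inequalities `0 ≤ A e x`. -/
def polyhedron (A : ι → E →ᵃ[ℝ] ℝ) : Set E := {x | ∀ e, 0 ≤ A e x}

/-- The points of the polyhedron at which all inequalities indexed by `S` are tight. -/
def tightFace (A : ι → E →ᵃ[ℝ] ℝ) (S : Set ι) : Set E :=
  {x ∈ polyhedron A | ∀ e ∈ S, A e x = 0}

omit [TopologicalSpace E] [IsTopologicalAddGroup E] [ContinuousSMul ℝ E] [T2Space E]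
  [FiniteDimensional ℝ E] in
theorem convex_polyhedron (A : ι → E →ᵃ[ℝ] ℝ) : Convex ℝ (polyhedron A) := by
  have : polyhedron A = ⋂ e, (A e) ⁻¹' (Ici 0) := by
    ext x; simp [polyhedron]
  rw [this]
  exact convex_iInter fun e => (convex_Ici 0).affine_preimage (A e)

variable {A : ι → E →ᵃ[ℝ] ℝ}

/-- Up to a constant, the exposing functional is minus the sum of the slacks in `S`. A sum of
nonnegative slacks attains its minimum `0`, at a point of the face, exactly where every slack
vanishes. -/
theorem isExposed_tightFace [Finite ι] {S : Set ι} (hS : (tightFace A S).Nonempty) :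
    IsExposed ℝ (polyhedron A) (tightFace A S) := by
  classical
  have := Fintype.ofFinite ι
  intro _
  obtain ⟨x₀, hx₀, hx₀S⟩ := hS
  refine ⟨LinearMap.toContinuousLinearMap (-∑ e ∈ S.toFinset, (A e).linear), ?_⟩
  have key : ∀ z, (-∑ e ∈ S.toFinset, (A e).linear) z =
      (∑ e ∈ S.toFinset, A e 0) - ∑ e ∈ S.toFinset, A e z := fun z => by
    rw [← Finset.sum_sub_distrib, LinearMap.neg_apply, LinearMap.sum_apply, ← Finset.sum_neg_distrib]
    refine Finset.sum_congr rfl fun e _ => ?_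
    have := (A e).map_vadd 0 z
    simp only [vadd_eq_add, add_zero] at this
    linarith
  have hsum : ∀ z ∈ polyhedron A, 0 ≤ ∑ e ∈ S.toFinset, A e z := fun z hz =>
    Finset.sum_nonneg fun e _ => hz e
  ext x
  simp only [tightFace, mem_ofPred_eq, LinearMap.coe_toContinuousLinearMap']
  refine and_congr_right fun hx => ⟨fun h y hy => ?_, fun h e he => ?_⟩
  · have : ∑ e ∈ S.toFinset, A e x = 0 :=
      Finset.sum_eq_zero fun e he => h e (by simpa using he)
    rw [key, key]
    linarith [hsum y hy]
  · have h1 := h x₀ hx₀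
    have : ∑ e ∈ S.toFinset, A e x₀ = 0 :=
      Finset.sum_eq_zero fun e he => hx₀S e (by simpa using he)
    rw [key, key] at h1
    have h2 : ∑ e ∈ S.toFinset, A e x = 0 := le_antisymm (by linarith) (hsum x hx)
    exact (Finset.sum_eq_zero_iff_of_nonneg fun e _ => hx e).1 h2 e (by simpa using he)

omit [T2Space E] [FiniteDimensional ℝ E] [IsTopologicalAddGroup E] [ContinuousSMul ℝ E] in
-- A relative interior point of `F`, found by averaging: at a midpoint a nonnegative slack vanishes
-- only if it vanishes at both ends, so each inequality can be made strict without losing the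
-- earlier ones.
theorem exists_mem_tight_only [Finite ι] {F : Set E} (hF : F.Nonempty)
    (hexp : IsExposed ℝ (polyhedron A) F) :
    ∃ x ∈ F, ∀ e, A e x = 0 → ∀ y ∈ F, A e y = 0 := by
  classical
  have := Fintype.ofFinite ι
  suffices H : ∀ s : Finset ι, ∃ x ∈ F, ∀ e ∈ s, A e x = 0 → ∀ y ∈ F, A e y = 0 by
    obtain ⟨x, hx, h⟩ := H Finset.univ
    exact ⟨x, hx, fun e => h e (Finset.mem_univ e)⟩
  intro s
  induction s using Finset.induction_on with
  | empty => exact ⟨hF.some, hF.some_mem, by simp⟩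
  | insert e s _ ih =>
    obtain ⟨x, hx, h⟩ := ih
    by_cases he : ∀ y ∈ F, A e y = 0
    · refine ⟨x, hx, fun e' he' => ?_⟩
      rcases Finset.mem_insert.1 he' with rfl | he'
      · exact fun _ => he
      · exact h e' he'
    · push Not at he
      obtain ⟨y, hy, hne⟩ := he
      refine ⟨midpoint ℝ x y, (hexp.convex (convex_polyhedron A)).midpoint_mem hx hy,
        fun e' he' h0 => ?_⟩
      have hx0 := hexp.subset hx e'
      have hy0 := hexp.subset hy e'
      rw [(A e').map_midpoint, midpoint_eq_smul_add] at h0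
      have h1 : A e' x + A e' y = 0 := by simpa using h0
      rcases Finset.mem_insert.1 he' with rfl | he'
      · exact absurd (by linarith) hne
      · exact h e' he' (by linarith)

omit [T2Space E] [FiniteDimensional ℝ E] [IsTopologicalAddGroup E] [ContinuousSMul ℝ E] in
/-- Every nonempty exposed face of a polyhedron is cut out by its tight inequalities. -/
theorem IsExposed.eq_tightFace [Finite ι] {F : Set E} (hF : F.Nonempty)
    (hexp : IsExposed ℝ (polyhedron A) F) :
    F = tightFace A {e | ∀ x ∈ F, A e x = 0} := by
  refine Subset.antisymm (fun x hx => ⟨hexp.subset hx, fun e he => he x hx⟩) ?_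
  rintro y ⟨hy, hyt⟩
  obtain ⟨x, hx, hxt⟩ := exists_mem_tight_only hF hexp
  have hxP := hexp.subset hx
  obtain ⟨l, hl⟩ := hexp hF
  -- The segment from `y` to the relative interior point `x` can be prolonged slightly beyond `x`
  -- inside the polyhedron. As `l` is maximal at `x`, it cannot increase along the prolongation,
  -- hence `l x ≤ l y`.
  have hev : ∀ᶠ ε in nhdsWithin (0 : ℝ) (Ioi 0), ∀ e, ε * A e y ≤ (1 + ε) * A e x := by
    rw [Filter.eventually_all]
    intro e
    rcases (hxP e).eq_or_lt with h0 | h0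
    · refine Filter.Eventually.of_forall fun ε => ?_
      rw [hyt e (hxt e h0.symm), ← h0]
      simp
    · have hc : Filter.Tendsto (fun ε : ℝ => (1 + ε) * A e x - ε * A e y) (nhds 0)
          (nhds ((1 + 0) * A e x - 0 * A e y)) :=
        Continuous.tendsto (by fun_prop) 0
      have := (hc.eventually (lt_mem_nhds (a := 0) (by simpa using h0))).filter_mono
        (nhdsWithin_le_nhds (s := Ioi 0))
      filter_upwards [this] with ε hε
      linarith
  obtain ⟨ε, hε, hpos⟩ := (hev.and self_mem_nhdsWithin).exists
  have hpos : 0 < ε := hpos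
  have hz : AffineMap.lineMap x y (-ε) ∈ polyhedron A := fun e => by
    rw [(A e).apply_lineMap, AffineMap.lineMap_apply]
    have := hε e
    simp only [vsub_eq_sub, smul_eq_mul, vadd_eq_add]
    linarith
  rw [hl] at hx ⊢
  have h1 := hx.2 _ hz
  have h2 : l (AffineMap.lineMap x y (-ε)) = -ε * (l y - l x) + l x := by
    simp [AffineMap.lineMap_apply]
  have h3 : l x ≤ l y := by
    rw [h2] at h1
    nlinarith
  exact ⟨hy, fun z hz => (hx.2 z hz).trans h3⟩

/-- Every inequality defines a proper nonempty face, and none of these faces contains another. -/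
structure IsIrredundant (A : ι → E →ᵃ[ℝ] ℝ) : Prop where
  exists_tight : ∀ e, ∃ x ∈ polyhedron A, A e x = 0
  exists_not_tight : ∀ e, ∃ x ∈ polyhedron A, A e x ≠ 0
  eq_of_imp : ∀ e g, (∀ x ∈ polyhedron A, A e x = 0 → A g x = 0) → e = g

/-- Tightness of `e` and `f` forces tightness of `g`. -/
def TightImp (A : ι → E →ᵃ[ℝ] ℝ) (e f g : ι) : Prop :=
  ∀ x ∈ polyhedron A, A e x = 0 → A f x = 0 → A g x = 0

variable [Finite ι]

/-! ### Facets, and the faithful action of automorphisms on them -/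

namespace IsIrredundant

variable (h : IsIrredundant A)

/-- The face on which the inequality `e` is tight. -/
def facet (e : ι) : PolytopeFace (polyhedron A) :=
  have hne : (tightFace A {e}).Nonempty := by
    obtain ⟨x, hx, h0⟩ := h.exists_tight e
    exact ⟨x, hx, by simpa using h0⟩
  ⟨tightFace A {e}, hne, isExposed_tightFace hne⟩

theorem le_facet_iff {G : PolytopeFace (polyhedron A)} {e : ι} :
    G ≤ h.facet e ↔ ∀ x ∈ G.1, A e x = 0 :=
  ⟨fun hG x hx => (hG hx).2 e rfl, fun hG x hx =>
    ⟨G.2.2.subset hx, fun e' he' => by rw [mem_singleton_iff.1 he']; exact hG x hx⟩⟩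

theorem le_iff {G H : PolytopeFace (polyhedron A)} :
    G ≤ H ↔ ∀ e, H ≤ h.facet e → G ≤ h.facet e := by
  refine ⟨fun hGH e he => hGH.trans he, fun hGH x hx => ?_⟩
  rw [H.2.2.eq_tightFace H.2.1]
  exact ⟨G.2.2.subset hx, fun e he => (h.le_facet_iff.1 (hGH e (h.le_facet_iff.2 he))) x hx⟩

theorem facet_le_facet {e g : ι} (hle : h.facet e ≤ h.facet g) : e = g :=
  h.eq_of_imp e g fun x hx h0 => h.le_facet_iff.1 hle x ⟨hx, by simpa using h0⟩

theorem facet_injective : Function.Injective h.facet := fun _ _ he => h.facet_le_facet he.le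

theorem exists_le_facet {G H : PolytopeFace (polyhedron A)} (hGH : ¬ H ≤ G) :
    ∃ e, G ≤ h.facet e := by
  by_contra! hne
  exact hGH (h.le_iff.2 fun e he => absurd he (hne e))

theorem exists_not_le_facet (e : ι) : ∃ H, ¬ H ≤ h.facet e := by
  obtain ⟨x, hx, h0⟩ := h.exists_not_tight e
  have hP : (tightFace A ∅).Nonempty := ⟨x, hx, by simp⟩
  exact ⟨⟨_, hP, isExposed_tightFace hP⟩, fun hle =>
    h0 (h.le_facet_iff.1 hle x ⟨hx, by simp⟩)⟩

/-- Facets are the maximal proper faces: the image of a facet is proper, so it lies in some facet.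
Pulling that facet back gives a face containing the original facet and again lying in a facet, and
irredundancy forces equality. -/
theorem exists_map_facet (φ : CombAut (polyhedron A)) (e : ι) :
    ∃ e', φ (h.facet e) = h.facet e' := by
  have step : ∀ (ψ : CombAut (polyhedron A)) (e : ι), ∃ e', ψ (h.facet e) ≤ h.facet e' := by
    intro ψ e
    obtain ⟨H, hH⟩ := h.exists_not_le_facet e
    exact h.exists_le_facet (H := ψ H) (by simpa using hH)
  obtain ⟨e', he'⟩ := step φ e
  obtain ⟨e'', he''⟩ := step φ.symm e'
  have h1 : h.facet e ≤ φ.symm (h.facet e') := φ.le_symm_apply.2 he'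
  have h2 := h.facet_le_facet (h1.trans he'')
  subst h2
  exact ⟨e', le_antisymm he' (φ.symm_apply_le.1 he'')⟩

/-- The action of combinatorial automorphisms on facets. -/
noncomputable def facetHom : CombAut (polyhedron A) →* Equiv.Perm ι :=
  MonoidHom.toHomPerm
    { toFun := fun φ e => (h.exists_map_facet φ e).choose
      map_one' := by
        funext e
        exact (h.facet_injective (h.exists_map_facet 1 e).choose_spec).symm
      map_mul' := fun φ ψ => by
        funext e
        apply h.facet_injective
        rw [← (h.exists_map_facet (φ * ψ) e).choose_spec]
        change φ (ψ (h.facet e)) = h.facet (h.exists_map_facet φ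
          (h.exists_map_facet ψ e).choose).choose
        rw [← (h.exists_map_facet φ _).choose_spec, ← (h.exists_map_facet ψ e).choose_spec] }

theorem map_facet (φ : CombAut (polyhedron A)) (e : ι) :
    φ (h.facet e) = h.facet (h.facetHom φ e) :=
  (h.exists_map_facet φ e).choose_spec

theorem facetHom_injective : Function.Injective h.facetHom := by
  rw [injective_iff_map_eq_one]
  intro φ hφ
  have hfix : ∀ e, φ (h.facet e) = h.facet e := fun e => by rw [h.map_facet, hφ]; rfl
  have hle : ∀ G e, φ G ≤ h.facet e ↔ G ≤ h.facet e := fun G e => by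
    conv_lhs => rw [← hfix e]
    exact φ.le_iff_le
  refine OrderIso.ext (funext fun G => ?_)
  exact le_antisymm (h.le_iff.2 fun e he => (hle G e).2 he)
    (h.le_iff.2 fun e he => (hle G e).1 he)

/-- Expresses the implication by the face order alone, so automorphisms preserve it. For the
converse, a point `x` is tested through the face of all inequalities tight at `x`. -/
theorem tightImp_iff {e f g : ι} :
    TightImp A e f g ↔
      ∀ G : PolytopeFace (polyhedron A), G ≤ h.facet e → G ≤ h.facet f → G ≤ h.facet g := by
  constructor
  · intro H G he hf
    rw [h.le_facet_iff] at *
    exact fun x hx => H x (G.2.2.subset hx) (he x hx) (hf x hx)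
  · intro H x hx he hf
    have hne : (tightFace A {e' | A e' x = 0}).Nonempty := ⟨x, hx, fun _ => id⟩
    have := H ⟨_, hne, isExposed_tightFace hne⟩ (h.le_facet_iff.2 fun y hy => hy.2 e he)
      (h.le_facet_iff.2 fun y hy => hy.2 f hf)
    exact h.le_facet_iff.1 this x ⟨hx, fun _ => id⟩

theorem tightImp_facetHom (φ : CombAut (polyhedron A)) (e f g : ι) :
    TightImp A (h.facetHom φ e) (h.facetHom φ f) (h.facetHom φ g) ↔ TightImp A e f g := by
  rw [h.tightImp_iff, h.tightImp_iff, ← h.map_facet, ← h.map_facet, ← h.map_facet,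
    φ.surjective.forall]
  simp only [φ.le_iff_le]

/-- An affine involution permuting the inequalities by `σ` induces `σ` on the facets. -/
theorem mem_range_facetHom (f : E →ᵃ[ℝ] E) (σ : Equiv.Perm ι)
    (hσ : ∀ e, σ (σ e) = e) (hfσ : ∀ e x, A e (f x) = A (σ e) x) (hf : ∀ x, f (f x) = x) :
    σ ∈ h.facetHom.range := by
  have hm : MapsTo f (polyhedron A) (polyhedron A) := fun x hx e => by
    rw [hfσ]; exact hx _
  refine ⟨faceIso f f hm hm (fun x _ => hf x) (fun x _ => hf x), Equiv.ext fun e => ?_⟩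
  refine h.facet_le_facet ?_
  rw [← h.map_facet, h.le_facet_iff]
  rintro _ ⟨x, hx, rfl⟩
  rw [hfσ, hσ]
  exact hx.2 e rfl

end IsIrredundant

end Faces

/-! ### The order polytope of a grid -/

/-- The facets of the order polytope of a grid, as edges of its Hasse diagram: the two unbounded
edges, and the horizontal and vertical grid edges at `(i, k)`. -/
inductive GridEdge : Type
  | bot | top
  | hor (i k : ℕ)
  | ver (i k : ℕ)
  deriving DecidableEq

/-! ### Edges, unit squares and separating staircases -/

namespace GridEdge

/-- The edge belongs to the grid with `m × n` unit squares. -/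
def Valid (m n : ℕ) : GridEdge → Prop
  | bot => True
  | top => True
  | hor i k => i < m ∧ k ≤ n
  | ver i k => i ≤ m ∧ k < n

/-- `{e, f}` are the two incoming or the two outgoing edges of a unit square,
and `g` is one of the other two edges of that square. -/
def Opp (m n : ℕ) (e f g : GridEdge) : Prop :=
  ∃ i k, i < m ∧ k < n ∧
    ((((e = ver i k ∧ f = hor i k) ∨ (e = hor i k ∧ f = ver i k)) ∧
        (g = ver (i + 1) k ∨ g = hor i (k + 1))) ∨
      (((e = ver (i + 1) k ∧ f = hor i (k + 1)) ∨ (e = hor i (k + 1) ∧ f = ver (i + 1) k)) ∧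
        (g = ver i k ∨ g = hor i k)))

/-- The staircase with column heights `h` separates the endpoints of the edge. -/
def Cuts (m n : ℕ) (h : ℕ → ℕ) : GridEdge → Prop
  | bot => n < h 0
  | top => h m = 0
  | hor i k => h i ≤ k ∧ k < h (i + 1)
  | ver i k => h i = k + 1

/-- The heights `α, …, α, β, γ, δ, δ, …` with `β` in position `i`. -/
def fourStep (i α β γ δ : ℕ) (j : ℕ) : ℕ :=
  if j < i then α else if j = i then β else if j = i + 1 then γ else δ

theorem monotone_fourStep {i α β γ δ : ℕ} (h₁ : α ≤ β) (h₂ : β ≤ γ) (h₃ : γ ≤ δ) :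
    Monotone (fourStep i α β γ δ) := by
  intro j j' hj
  unfold fourStep
  split_ifs <;> omega

/-- The edge is cut by the part of a staircase to the left of `hor i k`. -/
def CutsLeftHor (i k α β : ℕ) : GridEdge → Prop
  | bot => False
  | top => False
  | hor j l => (j + 1 = i ∧ α ≤ l ∧ l < β) ∨ (j = i ∧ β ≤ l ∧ l < k)
  | ver j l => (j < i ∧ α = l + 1) ∨ (j = i ∧ β = l + 1)

/-- The edge is cut by the part of a staircase to the right of `hor i k`. -/
def CutsRightHor (i k γ δ : ℕ) : GridEdge → Prop
  | bot => False
  | top => False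
  | hor j l => (j = i + 1 ∧ γ ≤ l ∧ l < δ) ∨ (j = i ∧ k < l ∧ l < γ)
  | ver j l => (i + 1 < j ∧ δ = l + 1) ∨ (j = i + 1 ∧ γ = l + 1)

/-- If all four candidates failed, `(0, 0)` would require one of `e`, `f` to be horizontal and `(k,
k)` would require the other to be vertical. Then `(0, k)` and `(k - 1, k - 1)` force these to be
`ver i (k - 1)` and `hor i (k - 1)`, the excluded pair. -/
theorem exists_left_hor (i k : ℕ) (e f : GridEdge)
    (h : ∀ l, k = l + 1 → ¬ ((e = ver i l ∧ f = hor i l) ∨ (e = hor i l ∧ f = ver i l))) :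
    ∃ α β, α ≤ β ∧ β ≤ k ∧ ¬ CutsLeftHor i k α β e ∧ ¬ CutsLeftHor i k α β f := by
  by_contra! H
  have hA := H 0 0
  have hB := H k k
  have hC := H 0 k
  have hD := H (k - 1) (k - 1)
  have h' := h (k - 1)
  cases e <;> cases f <;> simp [CutsLeftHor] at * <;> omega

theorem exists_right_hor {m n : ℕ} (i k : ℕ) (hk : k ≤ n) (e f : GridEdge) (he : e.Valid m n)
    (hf : f.Valid m n)
    (h : k < n → ¬ ((e = ver (i + 1) k ∧ f = hor i (k + 1)) ∨
      (e = hor i (k + 1) ∧ f = ver (i + 1) k))) :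
    ∃ γ δ, γ ≤ δ ∧ k < γ ∧ δ ≤ n + 1 ∧ ¬ CutsRightHor i k γ δ e ∧ ¬ CutsRightHor i k γ δ f := by
  by_contra! H
  have hA := H (n + 1) (n + 1)
  have hB := H (k + 1) (k + 1)
  have hC := H (k + 1) (n + 1)
  -- The minimum keeps the height admissible when `k = n`; height `n + 1` fills a column and cuts no
  -- valid vertical edge.
  have hD := H (min (k + 2) (n + 1)) (min (k + 2) (n + 1))
  cases e <;> cases f <;> simp [CutsRightHor, Valid] at * <;> omega

/-- The heights `α, …, α, β, c, γ, δ, δ, …` with `c` in position `i`. -/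
def fiveStep (i α β c γ δ : ℕ) (j : ℕ) : ℕ :=
  if j + 1 < i then α else if j + 1 = i then β else if j = i then c
  else if j = i + 1 then γ else δ

theorem monotone_fiveStep {i α β c γ δ : ℕ} (h₁ : α ≤ β) (h₂ : β ≤ c) (h₃ : c ≤ γ) (h₄ : γ ≤ δ) :
    Monotone (fiveStep i α β c γ δ) := by
  intro j j' hj
  unfold fiveStep
  split_ifs <;> omega

/-- The edge is cut by the part of a staircase to the left of `ver i k`. -/
def CutsLeftVer (i k α β : ℕ) : GridEdge → Prop
  | bot => False
  | top => False
  | hor j l => (j + 2 = i ∧ α ≤ l ∧ l < β) ∨ (j + 1 = i ∧ β ≤ l ∧ l < k + 1)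
  | ver j l => (j + 1 < i ∧ α = l + 1) ∨ (j + 1 = i ∧ β = l + 1)

/-- The edge is cut by the part of a staircase to the right of `ver i k`. -/
def CutsRightVer (i k γ δ : ℕ) : GridEdge → Prop
  | bot => False
  | top => False
  | hor j l => (j = i ∧ k + 1 ≤ l ∧ l < γ) ∨ (j = i + 1 ∧ γ ≤ l ∧ l < δ)
  | ver j l => (j = i + 1 ∧ γ = l + 1) ∨ (i + 1 < j ∧ δ = l + 1)

theorem exists_left_ver (i k : ℕ) (e f : GridEdge)
    (h : ∀ j, i = j + 1 → ¬ ((e = ver j k ∧ f = hor j k) ∨ (e = hor j k ∧ f = ver j k))) :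
    ∃ α β, α ≤ β ∧ β ≤ k + 1 ∧ ¬ CutsLeftVer i k α β e ∧ ¬ CutsLeftVer i k α β f := by
  by_contra! H
  have hA := H 0 0
  have hB := H (k + 1) (k + 1)
  have hC := H 0 (k + 1)
  have hD := H k k
  have h' := h (i - 1)
  cases e <;> cases f <;> simp [CutsLeftVer] at * <;> omega

theorem exists_right_ver {m n : ℕ} (i k : ℕ) (hk : k < n) (e f : GridEdge) (he : e.Valid m n)
    (hf : f.Valid m n)
    (h : i < m → ¬ ((e = ver (i + 1) k ∧ f = hor i (k + 1)) ∨
      (e = hor i (k + 1) ∧ f = ver (i + 1) k))) :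
    ∃ γ δ, γ ≤ δ ∧ k + 1 ≤ γ ∧ δ ≤ n + 1 ∧
      ¬ CutsRightVer i k γ δ e ∧ ¬ CutsRightVer i k γ δ f := by
  by_contra! H
  have hA := H (n + 1) (n + 1)
  have hB := H (k + 1) (k + 1)
  have hC := H (k + 1) (n + 1)
  have hD := H (k + 2) (k + 2)
  cases e <;> cases f <;> simp [CutsRightVer, Valid] at * <;> omega

theorem cuts_fourStep {m n i k α β γ δ : ℕ} (hi : i < m) (hk : k ≤ n) (hαβ : α ≤ β) (hβ : β ≤ k)
    (hγ : k < γ) (hγδ : γ ≤ δ) {e : GridEdge} (hne : hor i k ≠ e)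
    (h : Cuts m n (fourStep i α β γ δ) e) : CutsLeftHor i k α β e ∨ CutsRightHor i k γ δ e := by
  cases e <;> simp only [Cuts, fourStep, CutsLeftHor, CutsRightHor, ne_eq, hor.injEq] at * <;>
    split_ifs at h <;> omega

theorem cuts_fiveStep {m n i k α β γ δ : ℕ} (hi : i ≤ m) (hk : k < n) (hαβ : α ≤ β)
    (hβ : β ≤ k + 1) (hγ : k + 1 ≤ γ) (hγδ : γ ≤ δ) {e : GridEdge} (hne : ver i k ≠ e)
    (h : Cuts m n (fiveStep i α β (k + 1) γ δ) e) :
    CutsLeftVer i k α β e ∨ CutsRightVer i k γ δ e := by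
  cases e <;> simp only [Cuts, fiveStep, CutsLeftVer, CutsRightVer, ne_eq, ver.injEq] at * <;>
    split_ifs at h <;> omega

/-- A staircase through `g` splits into a part on each side of `g`, and the two parts can be chosen
independently. Avoiding `e` and `f` on one side is impossible only when they are the pair opposite
`g` in the unit square on that side. For `bot` and `top` the constant fillings suffice. -/
theorem exists_staircase {m n : ℕ} {e f g : GridEdge} (he : e.Valid m n) (hf : f.Valid m n)
    (hg : g.Valid m n) (hge : g ≠ e) (hgf : g ≠ f) (hO : ¬ Opp m n e f g) :
    ∃ h : ℕ → ℕ, Monotone h ∧ Cuts m n h g ∧ ¬ Cuts m n h e ∧ ¬ Cuts m n h f := by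
  cases g with
  | bot =>
    refine ⟨fun _ => n + 1, monotone_const, by simp [Cuts], ?_, ?_⟩
    · cases e <;> simp [Cuts, Valid] at he hge ⊢; omega
    · cases f <;> simp [Cuts, Valid] at hf hgf ⊢; omega
  | top =>
    refine ⟨fun _ => 0, monotone_const, by simp [Cuts], ?_, ?_⟩
    · cases e <;> simp [Cuts] at hge ⊢
    · cases f <;> simp [Cuts] at hgf ⊢
  | hor i k =>
    obtain ⟨hi, hk⟩ := hg
    obtain ⟨α, β, hαβ, hβ, h1, h2⟩ := exists_left_hor i k e f (by
      rintro l rfl hp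
      exact hO ⟨i, l, hi, hk, Or.inl ⟨hp, Or.inr rfl⟩⟩)
    obtain ⟨γ, δ, hγδ, hγ, -, h3, h4⟩ := exists_right_hor i k hk e f he hf (by
      intro hlt hp
      exact hO ⟨i, k, hi, hlt, Or.inr ⟨hp, Or.inr rfl⟩⟩)
    refine ⟨fourStep i α β γ δ, monotone_fourStep hαβ (by omega) hγδ, ?_, ?_, ?_⟩
    · simp [Cuts, fourStep]; omega
    · exact fun h => (cuts_fourStep hi hk hαβ hβ hγ hγδ hge h).elim h1 h3
    · exact fun h => (cuts_fourStep hi hk hαβ hβ hγ hγδ hgf h).elim h2 h4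
  | ver i k =>
    obtain ⟨hi, hk⟩ := hg
    obtain ⟨α, β, hαβ, hβ, h1, h2⟩ := exists_left_ver i k e f (by
      rintro j rfl hp
      exact hO ⟨j, k, hi, hk, Or.inl ⟨hp, Or.inl rfl⟩⟩)
    obtain ⟨γ, δ, hγδ, hγ, -, h3, h4⟩ := exists_right_ver i k hk e f he hf (by
      intro hlt hp
      exact hO ⟨i, k, hlt, hk, Or.inr ⟨hp, Or.inl rfl⟩⟩)
    refine ⟨fiveStep i α β (k + 1) γ δ, monotone_fiveStep hαβ hβ hγ hγδ, ?_, ?_, ?_⟩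
    · simp [Cuts, fiveStep]
    · exact fun h => (cuts_fiveStep hi hk hαβ hβ hγ hγδ hge h).elim h1 h3
    · exact fun h => (cuts_fiveStep hi hk hαβ hβ hγ hγδ hgf h).elim h2 h4

end GridEdge

/-! ### The order polytope of the grid and its staircase points -/

open GridEdge

/-- The edges of the grid with `m × n` unit squares. -/
abbrev Edges (m n : ℕ) : Type := {e : GridEdge // e.Valid m n}

instance finite_edges (m n : ℕ) : Finite (Edges m n) := by
  have : {e : GridEdge | e.Valid m n} ⊆ {bot, top} ∪
      (Set.image2 hor (Set.Iic m) (Set.Iic n) ∪ Set.image2 ver (Set.Iic m) (Set.Iic n)) := by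
    intro e he
    change e.Valid m n at he
    cases e <;> simp [Valid] at * <;> omega
  exact (Set.Finite.subset ((Set.toFinite _).union (((Set.finite_Iic m).image2 _
    (Set.finite_Iic n)).union ((Set.finite_Iic m).image2 _ (Set.finite_Iic n)))) this).to_subtype

/-- The space of real fillings of the grid with `m × n` unit squares. -/
abbrev GridSpace (m n : ℕ) : Type := Fin (m + 1) × Fin (n + 1) → ℝ

/-- The grid point with given natural number coordinates. -/
def gridPt (m n i k : ℕ) : Fin (m + 1) × Fin (n + 1) := (Fin.ofNat (m + 1) i, Fin.ofNat (n + 1) k)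

theorem gridPt_val {m n : ℕ} (p : Fin (m + 1) × Fin (n + 1)) : gridPt m n p.1 p.2 = p := by
  ext <;> simp [gridPt]

theorem gridPt_fst {m i : ℕ} (n k : ℕ) (hi : i ≤ m) : ((gridPt m n i k).1 : ℕ) = i := by
  simp [gridPt, Nat.mod_eq_of_lt (Nat.lt_succ_of_le hi)]

theorem gridPt_snd {n k : ℕ} (m i : ℕ) (hk : k ≤ n) : ((gridPt m n i k).2 : ℕ) = k := by
  simp [gridPt, Nat.mod_eq_of_lt (Nat.lt_succ_of_le hk)]

/-- The slack of the inequality attached to an edge. -/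
def gridSlack (m n : ℕ) : GridEdge → GridSpace m n →ᵃ[ℝ] ℝ
  | bot => (LinearMap.proj (gridPt m n 0 n)).toAffineMap
  | top => AffineMap.const ℝ _ 1 - (LinearMap.proj (gridPt m n m 0)).toAffineMap
  | hor i k => (LinearMap.proj (gridPt m n (i + 1) k)).toAffineMap -
      (LinearMap.proj (gridPt m n i k)).toAffineMap
  | ver i k => (LinearMap.proj (gridPt m n i k)).toAffineMap -
      (LinearMap.proj (gridPt m n i (k + 1))).toAffineMap

section slack_apply
variable {m n : ℕ} (x : GridSpace m n)

@[simp] theorem gridSlack_bot : gridSlack m n bot x = x (gridPt m n 0 n) := rfl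

@[simp] theorem gridSlack_top : gridSlack m n top x = 1 - x (gridPt m n m 0) := rfl

@[simp] theorem gridSlack_hor (i k : ℕ) :
    gridSlack m n (hor i k) x = x (gridPt m n (i + 1) k) - x (gridPt m n i k) := rfl

@[simp] theorem gridSlack_ver (i k : ℕ) :
    gridSlack m n (ver i k) x = x (gridPt m n i k) - x (gridPt m n i (k + 1)) := rfl

end slack_apply

/-- The inequalities of the order polytope of the grid. -/
def gridIneq (m n : ℕ) (e : Edges m n) : GridSpace m n →ᵃ[ℝ] ℝ := gridSlack m n e.1

/-- The indicator of the region below a staircase. -/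
noncomputable def stair (m n : ℕ) (h : ℕ → ℕ) : GridSpace m n :=
  fun p => if (p.2 : ℕ) < h p.1 then 1 else 0

theorem stair_gridPt {m n i k : ℕ} (h : ℕ → ℕ) (hi : i ≤ m) (hk : k ≤ n) :
    stair m n h (gridPt m n i k) = if k < h i then 1 else 0 := by
  simp only [stair, gridPt_fst n k hi, gridPt_snd m i hk]

theorem gridSlack_stair {m n : ℕ} {h : ℕ → ℕ} (hh : Monotone h) {e : GridEdge}
    (he : e.Valid m n) :
    (Cuts m n h e → gridSlack m n e (stair m n h) = 1) ∧
      (¬ Cuts m n h e → gridSlack m n e (stair m n h) = 0) := by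
  cases e with
  | bot =>
    rw [gridSlack_bot, stair_gridPt _ (Nat.zero_le _) le_rfl]
    exact ⟨fun hc => if_pos hc, fun hc => if_neg hc⟩
  | top =>
    rw [gridSlack_top, stair_gridPt _ le_rfl (Nat.zero_le _)]
    simp only [Cuts]
    split_ifs <;> constructor <;> intro _ <;> first | omega | norm_num
  | hor i k =>
    have hi : i + 1 ≤ m := he.1
    have := hh (Nat.le_add_right i 1)
    rw [gridSlack_hor, stair_gridPt _ hi he.2, stair_gridPt _ he.1.le he.2]
    simp only [Cuts]
    split_ifs <;> constructor <;> intro _ <;> first | omega | norm_num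
  | ver i k =>
    have hk : k + 1 ≤ n := he.2
    rw [gridSlack_ver, stair_gridPt _ he.1 he.2.le, stair_gridPt _ he.1 hk]
    simp only [Cuts]
    split_ifs <;> constructor <;> intro _ <;> first | omega | norm_num

theorem stair_mem {m n : ℕ} {h : ℕ → ℕ} (hh : Monotone h) :
    stair m n h ∈ polyhedron (gridIneq m n) := by
  intro e
  by_cases hc : Cuts m n h e.1
  · exact ((gridSlack_stair hh e.2).1 hc).symm ▸ zero_le_one
  · exact ((gridSlack_stair hh e.2).2 hc).ge

theorem stair_tight_iff {m n : ℕ} {h : ℕ → ℕ} (hh : Monotone h) (e : Edges m n) :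
    gridIneq m n e (stair m n h) = 0 ↔ ¬ Cuts m n h e.1 :=
  ⟨fun h0 hc => one_ne_zero (((gridSlack_stair hh e.2).1 hc).symm.trans h0),
    (gridSlack_stair hh e.2).2⟩

/-- The two tight edges form a chain from the minimum to the maximum of the square, so all four
entries coincide. -/
theorem tightImp_of_opp {m n : ℕ} {e f g : Edges m n} (h : Opp m n e.1 f.1 g.1) :
    TightImp (gridIneq m n) e f g := by
  obtain ⟨e, he⟩ := e
  obtain ⟨f, hf⟩ := f
  obtain ⟨g, hg⟩ := g
  obtain ⟨i, k, hi, hk, h⟩ := h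
  intro x hx h1 h2
  have a1 := hx ⟨hor i k, hi, hk.le⟩
  have a2 := hx ⟨hor i (k + 1), hi, hk⟩
  have a3 := hx ⟨ver i k, hi.le, hk⟩
  have a4 := hx ⟨ver (i + 1) k, hi, hk⟩
  dsimp only at h
  simp only [gridIneq, gridSlack_hor, gridSlack_ver] at *
  rcases h with ⟨⟨rfl, rfl⟩ | ⟨rfl, rfl⟩, rfl | rfl⟩ | ⟨⟨rfl, rfl⟩ | ⟨rfl, rfl⟩, rfl | rfl⟩ <;>
    simp only [gridSlack_hor, gridSlack_ver] at * <;> linarith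

theorem tightImp_grid_iff {m n : ℕ} {e f g : Edges m n} :
    TightImp (gridIneq m n) e f g ↔ g = e ∨ g = f ∨ Opp m n e.1 f.1 g.1 := by
  refine ⟨fun h => ?_, ?_⟩
  · by_contra! hne
    obtain ⟨h1, h2, h3⟩ := hne
    obtain ⟨st, hst, hg, he, hf⟩ := exists_staircase e.2 f.2 g.2
      (fun h => h1 (Subtype.ext h)) (fun h => h2 (Subtype.ext h)) h3
    exact (stair_tight_iff hst g).1 (h _ (stair_mem hst) ((stair_tight_iff hst e).2 he)
      ((stair_tight_iff hst f).2 hf)) hg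
  · rintro (rfl | rfl | h)
    · exact fun _ _ h _ => h
    · exact fun _ _ _ h => h
    · exact tightImp_of_opp h

theorem GridEdge.not_opp_self (m n : ℕ) (e g : GridEdge) : ¬ Opp m n e e g := by
  rintro ⟨i, k, -, -, h⟩
  grind

theorem isIrredundant_gridIneq (m n : ℕ) : IsIrredundant (gridIneq m n) where
  exists_tight e := by
    by_cases he : e.1 = bot
    · refine ⟨stair m n fun _ => 0, stair_mem monotone_const,
        (stair_tight_iff monotone_const e).2 ?_⟩
      simp [he, Cuts]
    · refine ⟨stair m n fun _ => n + 1, stair_mem monotone_const,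
        (stair_tight_iff monotone_const e).2 ?_⟩
      have hv := e.2
      generalize e.1 = e' at *
      cases e' <;> simp [Cuts, Valid] at *; omega
  exists_not_tight e := by
    obtain ⟨f, hf⟩ : ∃ f : Edges m n, e ≠ f := by
      by_cases he : e.1 = bot
      · exact ⟨⟨top, trivial⟩, fun h => by simp [h] at he⟩
      · exact ⟨⟨bot, trivial⟩, fun h => he (by rw [h])⟩
    -- The choice `f = f` rules out squares, so a point tight at `f` but not at `e` exists.
    have h : ¬ TightImp (gridIneq m n) f f e := by
      rw [tightImp_grid_iff]
      simp [hf, not_opp_self]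
    simp only [TightImp] at h
    push Not at h
    obtain ⟨x, hx, -, -, h⟩ := h
    exact ⟨x, hx, h⟩
  eq_of_imp e g h := by
    have : TightImp (gridIneq m n) e e g := fun x hx h0 _ => h x hx h0
    rw [tightImp_grid_iff] at this
    simpa [not_opp_self, eq_comm] using this

/-! ### The Gelfand-Tsetlin polytope as an order polytope -/

section Transfer

variable {m n : ℕ}

theorem gridPt_mono_left {x : GridSpace m n} (hx : x ∈ polyhedron (gridIneq m n)) {i j k : ℕ}
    (hij : i ≤ j) (hj : j ≤ m) (hk : k ≤ n) : x (gridPt m n i k) ≤ x (gridPt m n j k) := by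
  induction j, hij using Nat.le_induction with
  | base => exact le_rfl
  | succ j _ ih =>
    have := hx ⟨hor j k, hj, hk⟩
    rw [gridIneq, gridSlack_hor] at this
    exact (ih (by omega)).trans (by linarith)

theorem gridPt_anti_right {x : GridSpace m n} (hx : x ∈ polyhedron (gridIneq m n)) {i k l : ℕ}
    (hkl : k ≤ l) (hi : i ≤ m) (hl : l ≤ n) : x (gridPt m n i l) ≤ x (gridPt m n i k) := by
  induction l, hkl using Nat.le_induction with
  | base => exact le_rfl
  | succ l _ ih =>
    have := hx ⟨ver i l, hi, hl⟩
    rw [gridIneq, gridSlack_ver] at this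
    exact le_trans (by linarith) (ih (by omega))

theorem gridPt_nonneg {x : GridSpace m n} (hx : x ∈ polyhedron (gridIneq m n)) {i k : ℕ}
    (hi : i ≤ m) (hk : k ≤ n) : 0 ≤ x (gridPt m n i k) := by
  have h0 := hx ⟨bot, trivial⟩
  rw [gridIneq, gridSlack_bot] at h0
  exact h0.trans ((gridPt_mono_left hx (Nat.zero_le i) hi le_rfl).trans
    (gridPt_anti_right hx hk hi le_rfl))

theorem gridPt_le_one {x : GridSpace m n} (hx : x ∈ polyhedron (gridIneq m n)) {i k : ℕ}
    (hi : i ≤ m) (hk : k ≤ n) : x (gridPt m n i k) ≤ 1 := by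
  have h0 := hx ⟨top, trivial⟩
  rw [gridIneq, gridSlack_top] at h0
  exact (gridPt_mono_left hx hi le_rfl hk).trans
    ((gridPt_anti_right hx (Nat.zero_le k) le_rfl hk).trans (by linarith))

/-- The position in the triangular array of a grid point. -/
def triPt (m n : ℕ) (p : Fin (m + 1) × Fin (n + 1)) : TriIdx ((m + 1) + (n + 1)) :=
  -- The row index is reversed, so the corner `(0, 0)` of the grid lies in the last row and entries
  -- decrease in the second coordinate.
  ⟨(⟨m + 1 + n - p.2, by omega⟩, ⟨p.1, by omega⟩), by
    simp only [Fin.mk_le_mk]; omega⟩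

/-- Restriction of a triangular array to its free entries. -/
noncomputable def gtToGrid (m n : ℕ) :
    (TriIdx ((m + 1) + (n + 1)) → ℝ) →ᵃ[ℝ] GridSpace m n :=
  (LinearMap.funLeft ℝ ℝ (triPt m n)).toAffineMap - AffineMap.const ℝ _ (1 : GridSpace m n)

theorem gtToGrid_apply (x : TriIdx ((m + 1) + (n + 1)) → ℝ) (p) :
    gtToGrid m n x p = x (triPt m n p) - 1 := rfl

/-- Extension of a filling of the grid to a triangular array. -/
noncomputable def gridToGT (m n : ℕ) :
    GridSpace m n →ᵃ[ℝ] (TriIdx ((m + 1) + (n + 1)) → ℝ) where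
  toFun y q := if (q.row : ℕ) ≤ m then 1 else if m < (q.col : ℕ) then 2 else
    1 + y (gridPt m n q.col (m + 1 + n - q.row))
  linear :=
    { toFun := fun y q => if (q.row : ℕ) ≤ m then 0 else if m < (q.col : ℕ) then 0 else
        y (gridPt m n q.col (m + 1 + n - q.row))
      map_add' := fun y z => by
        ext q; simp only [Pi.add_apply]; split_ifs <;> simp
      map_smul' := fun c y => by
        ext q; simp only [Pi.smul_apply, RingHom.id_apply]; split_ifs <;> simp }
  map_vadd' y v := by
    ext q
    simp only [vadd_eq_add, Pi.add_apply, LinearMap.coe_mk, AddHom.coe_mk]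
    split_ifs <;> ring

theorem gridToGT_apply (y : GridSpace m n) (q : TriIdx ((m + 1) + (n + 1))) :
    gridToGT m n y q = if (q.row : ℕ) ≤ m then 1 else if m < (q.col : ℕ) then 2 else
      1 + y (gridPt m n q.col (m + 1 + n - q.row)) := rfl

theorem TriIdx.ext_val {N : ℕ} {p q : TriIdx N} (h₁ : (p.row : ℕ) = q.row)
    (h₂ : (p.col : ℕ) = q.col) : p = q :=
  Subtype.ext (Prod.ext (Fin.ext h₁) (Fin.ext h₂))

/-- Induction on the distance to the diagonal, along the column for the lower bound and along the
row for the upper one. It pins rows of index at most `m` to `1` and columns of index above `m` to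
`2`. -/
theorem GTPolytope.le_diag {N : ℕ} {lam : Fin N → ℕ} {x : TriIdx N → ℝ}
    (hx : x ∈ GTPolytope lam) (q : TriIdx N) :
    (lam q.col : ℝ) ≤ x q ∧ x q ≤ lam q.row := by
  obtain ⟨hd, hr, hc⟩ := hx
  constructor
  · have H : ∀ d : ℕ, ∀ q : TriIdx N, (q.row : ℕ) = q.col + d → (lam q.col : ℝ) ≤ x q := by
      intro d
      induction d with
      | zero =>
        intro q hq
        have : q = TriIdx.diag q.col := TriIdx.ext_val hq rfl
        rw [← hd, ← this]
      | succ d ih =>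
        intro q hq
        let p : TriIdx N := ⟨(⟨q.row - 1, by omega⟩, q.col), by
          rw [Fin.le_def]; simp only; omega⟩
        have hp1 : (p.row : ℕ) = q.row - 1 := rfl
        exact (ih p (by rw [hp1]; change _ = (q.col : ℕ) + d; omega)).trans
          (hr p q (by omega) rfl)
    exact H (q.row - q.col) q (by have := Fin.le_def.1 q.2; change (q.col : ℕ) ≤ q.row at this; omega)
  · have H : ∀ d : ℕ, ∀ q : TriIdx N, (q.row : ℕ) = q.col + d → x q ≤ (lam q.row : ℝ) := by
      intro d
      induction d with
      | zero =>
        intro q hq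
        have : q = TriIdx.diag q.row := TriIdx.ext_val rfl hq.symm
        rw [← hd, ← this]
      | succ d ih =>
        intro q hq
        let p : TriIdx N := ⟨(q.row, ⟨q.col + 1, by omega⟩), by
          rw [Fin.le_def]; simp only; omega⟩
        have hp1 : (p.col : ℕ) = q.col + 1 := rfl
        exact (hc q p rfl hp1).trans (ih p (by change (q.row : ℕ) = _; omega))
    exact H (q.row - q.col) q (by have := Fin.le_def.1 q.2; change (q.col : ℕ) ≤ q.row at this; omega)

theorem gtToGrid_mapsTo :
    Set.MapsTo (gtToGrid m n) (GTPolytope (twoPartPartition (m + 1) (n + 1)))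
      (polyhedron (gridIneq m n)) := by
  intro x hx e
  have hb := GTPolytope.le_diag hx
  obtain ⟨-, hr, hc⟩ := hx
  obtain ⟨e, he⟩ := e
  cases e with
  | bot =>
    rw [gridIneq, gridSlack_bot, gtToGrid_apply]
    have := (hb (triPt m n (gridPt m n 0 n))).1
    have h1 : (1 : ℝ) ≤ twoPartPartition (m + 1) (n + 1) (triPt m n (gridPt m n 0 n)).col := by
      rw [twoPartPartition]; split_ifs <;> norm_num
    linarith
  | top =>
    rw [gridIneq, gridSlack_top, gtToGrid_apply]
    have := (hb (triPt m n (gridPt m n m 0))).2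
    have h1 : (twoPartPartition (m + 1) (n + 1) (triPt m n (gridPt m n m 0)).row : ℝ) ≤ 2 := by
      rw [twoPartPartition]; split_ifs <;> norm_num
    linarith
  | hor i k =>
    have hi : i + 1 ≤ m := he.1
    rw [gridIneq, gridSlack_hor, gtToGrid_apply, gtToGrid_apply]
    have := hc (triPt m n (gridPt m n i k)) (triPt m n (gridPt m n (i + 1) k)) rfl (by
      change ((gridPt m n (i + 1) k).1 : ℕ) = (gridPt m n i k).1 + 1
      rw [gridPt_fst _ _ hi, gridPt_fst _ _ (by omega)])
    linarith
  | ver i k =>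
    have hk : k + 1 ≤ n := he.2
    rw [gridIneq, gridSlack_ver, gtToGrid_apply, gtToGrid_apply]
    have := hr (triPt m n (gridPt m n i (k + 1))) (triPt m n (gridPt m n i k)) (by
      change m + 1 + n - ((gridPt m n i k).2 : ℕ) = m + 1 + n - (gridPt m n i (k + 1)).2 + 1
      rw [gridPt_snd _ _ hk, gridPt_snd _ _ (by omega)]
      omega) rfl
    linarith

theorem gridToGT_mapsTo :
    Set.MapsTo (gridToGT m n) (polyhedron (gridIneq m n))
      (GTPolytope (twoPartPartition (m + 1) (n + 1))) := by
  intro y hy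
  have hle : ∀ q : TriIdx ((m + 1) + (n + 1)), (q.col : ℕ) ≤ q.row := fun q => Fin.le_def.1 q.2
  have h0 := @gridPt_nonneg m n y hy
  have h1 := @gridPt_le_one m n y hy
  refine ⟨fun i => ?_, fun p q hrow hcol => ?_, fun p q hrow hcol => ?_⟩
  · rw [gridToGT_apply, twoPartPartition]
    change (if (i : ℕ) ≤ m then (1 : ℝ) else if m < (i : ℕ) then 2 else _) = _
    split_ifs <;> first | omega | norm_num
  · rw [gridToGT_apply, gridToGT_apply]
    have hcol' : (q.col : ℕ) = p.col := by rw [hcol]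
    have := hle p
    have := hle q
    have hqr := q.row.2
    rw [hrow, hcol']
    have a0 := @h0 p.col (m + 1 + n - (p.row + 1))
    have a2 := @gridPt_anti_right m n y hy p.col (m + 1 + n - (p.row + 1)) (m + 1 + n - p.row)
    split_ifs <;> first
      | (exfalso; omega)
      | (norm_num; done)
      | linarith [a0 (by omega) (by omega)]
      | linarith [a2 (by omega) (by omega) (by omega)]
  · rw [gridToGT_apply, gridToGT_apply]
    have hrow' : (q.row : ℕ) = p.row := by rw [hrow]
    have := hle p
    have := hle q
    have hqr := q.row.2
    rw [hrow', hcol]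
    have a1 := @h1 p.col (m + 1 + n - (p.row))
    have a2 := @gridPt_mono_left m n y hy p.col (p.col + 1) (m + 1 + n - p.row)
    split_ifs <;> first
      | (exfalso; omega)
      | (norm_num; done)
      | linarith [a1 (by omega) (by omega)]
      | linarith [a2 (by omega) (by omega) (by omega)]

theorem gridToGT_gtToGrid {x : TriIdx ((m + 1) + (n + 1)) → ℝ}
    (hx : x ∈ GTPolytope (twoPartPartition (m + 1) (n + 1))) :
    gridToGT m n (gtToGrid m n x) = x := by
  ext q
  have hb := GTPolytope.le_diag hx q
  have hle : (q.col : ℕ) ≤ q.row := Fin.le_def.1 q.2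
  have hqr := q.row.2
  rw [gridToGT_apply]
  simp only [twoPartPartition] at hb
  split_ifs with h1 h2
  · rw [if_pos (by omega), if_pos (by omega)] at hb
    norm_num at hb
    linarith
  · rw [if_neg (by omega), if_neg (by omega)] at hb
    norm_num at hb
    linarith
  · have : triPt m n (gridPt m n q.col (m + 1 + n - q.row)) = q := by
      apply TriIdx.ext_val
      · change m + 1 + n - ((gridPt m n q.col (m + 1 + n - q.row)).2 : ℕ) = _
        rw [gridPt_snd _ _ (by omega)]
        omega
      · exact gridPt_fst n (m + 1 + n - q.row) (by omega)
    rw [gtToGrid_apply, this]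
    ring

theorem gtToGrid_gridToGT (y : GridSpace m n) : gtToGrid m n (gridToGT m n y) = y := by
  ext p
  rw [gtToGrid_apply, gridToGT_apply]
  have h1 : ((triPt m n p).row : ℕ) = m + 1 + n - p.2 := rfl
  have h2 : ((triPt m n p).col : ℕ) = p.1 := rfl
  have := p.1.2
  have := p.2.2
  rw [h1, h2, if_neg (by omega), if_neg (by omega),
    show m + 1 + n - (m + 1 + n - (p.2 : ℕ)) = p.2 by omega, gridPt_val]
  ring

/-- The combinatorial automorphisms of the Gelfand-Tsetlin polytope are those of the grid. -/
noncomputable def combAutGTEquiv (m n : ℕ) :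
    CombAut (GTPolytope (twoPartPartition (m + 1) (n + 1))) ≃* CombAut (polyhedron (gridIneq m n)) :=
  let φ := faceIso (gtToGrid m n) (gridToGT m n) gtToGrid_mapsTo gridToGT_mapsTo
    (fun _ hx => gridToGT_gtToGrid hx) (fun y _ => gtToGrid_gridToGT y)
  { toFun := fun ψ => (φ.symm.trans ψ).trans φ
    invFun := fun ψ => (φ.trans ψ).trans φ.symm
    left_inv := fun ψ => by ext; simp
    right_inv := fun ψ => by ext; simp
    map_mul' := fun ψ χ => by
      refine OrderIso.ext (funext fun F => ?_)
      change φ (ψ (χ (φ.symm F))) = φ (ψ (φ.symm (φ (χ (φ.symm F)))))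
      rw [φ.symm_apply_apply] }

end Transfer

/-! ### Affine symmetries of the order polytope of a grid -/

namespace GridEdge

/-- The effect on edges of the half turn of the grid. -/
def rot (m n : ℕ) : GridEdge → GridEdge
  | bot => top
  | top => bot
  | hor i k => hor (m - 1 - i) (n - k)
  | ver i k => ver (m - i) (n - 1 - k)

/-- The effect on edges of exchanging the two coordinates. -/
def flip : GridEdge → GridEdge
  | bot => top
  | top => bot
  | hor i k => ver k i
  | ver i k => hor k i

theorem Valid.rot {m n : ℕ} {e : GridEdge} (h : e.Valid m n) : (e.rot m n).Valid m n := by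
  cases e <;> simp only [Valid, GridEdge.rot] at * <;> omega

theorem Valid.rot_rot {m n : ℕ} {e : GridEdge} (h : e.Valid m n) : (e.rot m n).rot m n = e := by
  cases e <;> simp only [Valid, GridEdge.rot, hor.injEq, ver.injEq] at * <;> omega

theorem Valid.flip {m n : ℕ} {e : GridEdge} (h : e.Valid m n) : e.flip.Valid n m := by
  cases e <;> simp only [Valid, GridEdge.flip] at * <;> omega

theorem flip_flip (e : GridEdge) : e.flip.flip = e := by
  cases e <;> rfl

end GridEdge

theorem Edges.ne_of_val_ne {m n : ℕ} {e f : Edges m n} (h : e.1 ≠ f.1) : e ≠ f :=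
  fun h' => h (congrArg _ h')

section Symmetries

variable (m n : ℕ)

/-- The half turn as a permutation of the edges. -/
def rotPerm : Equiv.Perm (Edges m n) :=
  Function.Involutive.toPerm (fun e => ⟨e.1.rot m n, e.2.rot⟩) fun e => Subtype.ext e.2.rot_rot

/-- Exchanging the two coordinates, on edges. -/
def flipEquiv : Edges m n ≃ Edges n m where
  toFun e := ⟨e.1.flip, e.2.flip⟩
  invFun e := ⟨e.1.flip, e.2.flip⟩
  left_inv e := Subtype.ext (flip_flip e.1)
  right_inv e := Subtype.ext (flip_flip e.1)

/-- Exchange of the two unbounded edges. -/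
def apexSwap : Equiv.Perm (Edges m n) := Equiv.swap ⟨bot, trivial⟩ ⟨top, trivial⟩

variable {m n}

/-- Exchange of the two edges at the corner `(0, 0)`. -/
def cornerSwap (hm : 0 < m) (hn : 0 < n) : Equiv.Perm (Edges m n) :=
  Equiv.swap ⟨hor 0 0, hm, Nat.zero_le _⟩ ⟨ver 0 0, Nat.zero_le _, hn⟩

theorem gridPt_eq_iff {i j k l : ℕ} (hi : i ≤ m) (hj : j ≤ m) (hk : k ≤ n) (hl : l ≤ n) :
    gridPt m n i k = gridPt m n j l ↔ i = j ∧ k = l := by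
  constructor
  · intro h
    have h1 := gridPt_fst n k hi
    have h2 := gridPt_snd m i hk
    rw [h] at h1 h2
    rw [gridPt_fst n l hj] at h1
    rw [gridPt_snd m j hl] at h2
    exact ⟨h1.symm, h2.symm⟩
  · rintro ⟨rfl, rfl⟩; rfl

variable (m n)

/-- The affine map exchanging the constant fillings `0` and `1` and fixing all other vertices. -/
def apexMap : GridSpace m n →ᵃ[ℝ] GridSpace m n where
  toFun x p := x p + (1 - x (gridPt m n m 0) - x (gridPt m n 0 n))
  linear :=
    { toFun := fun x p => x p - x (gridPt m n m 0) - x (gridPt m n 0 n)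
      map_add' := fun x y => by ext p; simp only [Pi.add_apply]; ring
      map_smul' := fun c x => by
        ext p; simp only [Pi.smul_apply, smul_eq_mul, RingHom.id_apply]; ring }
  map_vadd' x v := by
    ext p
    simp only [vadd_eq_add, Pi.add_apply, LinearMap.coe_mk, AddHom.coe_mk]
    ring

/-- The affine map reflecting the entry at the corner `(0, 0)` between its two neighbours. -/
def cornerMap : GridSpace m n →ᵃ[ℝ] GridSpace m n where
  toFun x p := if p = gridPt m n 0 0 then x (gridPt m n 0 1) + x (gridPt m n 1 0) - x p else x p
  linear :=
    { toFun := fun x p =>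
        if p = gridPt m n 0 0 then x (gridPt m n 0 1) + x (gridPt m n 1 0) - x p else x p
      map_add' := fun x y => by ext p; simp only [Pi.add_apply]; split_ifs <;> ring
      map_smul' := fun c x => by
        ext p; simp only [Pi.smul_apply, smul_eq_mul, RingHom.id_apply]; split_ifs <;> ring }
  map_vadd' x v := by
    ext p
    simp only [vadd_eq_add, Pi.add_apply, LinearMap.coe_mk, AddHom.coe_mk]
    split_ifs <;> ring

/-- The half turn of the grid combined with exchanging `0` and `1`. -/
def rotMap : GridSpace m n →ᵃ[ℝ] GridSpace m n where
  toFun x p := 1 - x (gridPt m n (m - p.1) (n - p.2))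
  linear :=
    { toFun := fun x p => - x (gridPt m n (m - p.1) (n - p.2))
      map_add' := fun x y => by ext p; simp only [Pi.add_apply]; ring
      map_smul' := fun c x => by
        ext p; simp only [Pi.smul_apply, smul_eq_mul, RingHom.id_apply]; ring }
  map_vadd' x v := by
    ext p
    simp only [vadd_eq_add, Pi.add_apply, LinearMap.coe_mk, AddHom.coe_mk]
    ring

/-- Exchanging the coordinates of the grid combined with exchanging `0` and `1`. -/
def flipMap : GridSpace m m →ᵃ[ℝ] GridSpace m m where
  toFun x p := 1 - x (p.2, p.1)
  linear :=
    { toFun := fun x p => - x (p.2, p.1)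
      map_add' := fun x y => by ext p; simp only [Pi.add_apply]; ring
      map_smul' := fun c x => by
        ext p; simp only [Pi.smul_apply, smul_eq_mul, RingHom.id_apply]; ring }
  map_vadd' x v := by
    ext p
    simp only [vadd_eq_add, Pi.add_apply, LinearMap.coe_mk, AddHom.coe_mk]
    ring

theorem apexMap_apply (x : GridSpace m n) (p) :
    apexMap m n x p = x p + (1 - x (gridPt m n m 0) - x (gridPt m n 0 n)) := rfl

theorem cornerMap_apply (x : GridSpace m n) (p) : cornerMap m n x p =
    if p = gridPt m n 0 0 then x (gridPt m n 0 1) + x (gridPt m n 1 0) - x p else x p := rfl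

theorem rotMap_apply (x : GridSpace m n) (p) :
    rotMap m n x p = 1 - x (gridPt m n (m - p.1) (n - p.2)) := rfl

theorem flipMap_gridPt (x : GridSpace m m) (i k : ℕ) :
    flipMap m x (gridPt m m i k) = 1 - x (gridPt m m k i) := rfl

variable {m n}

theorem rotMap_gridPt (x : GridSpace m n) {i k : ℕ} (hi : i ≤ m) (hk : k ≤ n) :
    rotMap m n x (gridPt m n i k) = 1 - x (gridPt m n (m - i) (n - k)) := by
  rw [rotMap_apply, gridPt_fst n k hi, gridPt_snd m i hk]

theorem cornerMap_gridPt (x : GridSpace m n) {i k : ℕ} (hi : i ≤ m) (hk : k ≤ n) :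
    cornerMap m n x (gridPt m n i k) = if i = 0 ∧ k = 0 then
      x (gridPt m n 0 1) + x (gridPt m n 1 0) - x (gridPt m n i k) else x (gridPt m n i k) := by
  rw [cornerMap_apply]
  simp only [gridPt_eq_iff hi (Nat.zero_le m) hk (Nat.zero_le n)]

/-- Adding one constant to all entries preserves their differences; the constant is chosen so that
the new minimum is `1` minus the old maximum. -/
theorem apexSwap_mem : apexSwap m n ∈ (isIrredundant_gridIneq m n).facetHom.range := by
  refine (isIrredundant_gridIneq m n).mem_range_facetHom (apexMap m n) _
    (fun e => Equiv.swap_apply_self _ _ e) (fun e x => ?_) fun x => ?_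
  · obtain ⟨e, he⟩ := e
    cases e with
    | bot =>
      rw [apexSwap,
        Equiv.swap_apply_left]
      simp only [gridIneq, gridSlack_bot, gridSlack_top, apexMap_apply]
      ring
    | top =>
      rw [apexSwap,
        Equiv.swap_apply_right]
      simp only [gridIneq, gridSlack_bot, gridSlack_top, apexMap_apply]
      ring
    | hor i k =>
      rw [apexSwap,
        Equiv.swap_apply_of_ne_of_ne (Edges.ne_of_val_ne (by simp)) (Edges.ne_of_val_ne (by simp))]
      simp only [gridIneq, gridSlack_hor, apexMap_apply]
      ring
    | ver i k =>
      rw [apexSwap,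
        Equiv.swap_apply_of_ne_of_ne (Edges.ne_of_val_ne (by simp)) (Edges.ne_of_val_ne (by simp))]
      simp only [gridIneq, gridSlack_ver, apexMap_apply]
      ring
  · ext p
    simp only [apexMap_apply]
    ring

/-- The half turn reverses the order of the grid, and `x ↦ 1 - x` restores it. -/
theorem rotPerm_mem : rotPerm m n ∈ (isIrredundant_gridIneq m n).facetHom.range := by
  refine (isIrredundant_gridIneq m n).mem_range_facetHom (rotMap m n) _
    (fun e => Subtype.ext e.2.rot_rot) (fun e x => ?_) fun x => ?_
  · obtain ⟨e, he⟩ := e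
    change gridSlack m n e _ = gridSlack m n (e.rot m n) x
    cases e with
    | bot =>
      simp only [GridEdge.rot, gridSlack_bot, gridSlack_top]
      rw [rotMap_gridPt x (Nat.zero_le m) le_rfl, Nat.sub_self, Nat.sub_zero]
    | top =>
      simp only [GridEdge.rot, gridSlack_bot, gridSlack_top]
      rw [rotMap_gridPt x le_rfl (Nat.zero_le n), Nat.sub_self, Nat.sub_zero]
      ring
    | hor i k =>
      have hi : i + 1 ≤ m := he.1
      simp only [GridEdge.rot, gridSlack_hor]
      rw [rotMap_gridPt x hi he.2, rotMap_gridPt x (by omega) he.2,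
        show m - 1 - i + 1 = m - i by omega, show m - 1 - i = m - (i + 1) by omega]
      ring
    | ver i k =>
      have hk : k + 1 ≤ n := he.2
      simp only [GridEdge.rot, gridSlack_ver]
      rw [rotMap_gridPt x he.1 hk, rotMap_gridPt x he.1 (by omega),
        show n - 1 - k + 1 = n - k by omega, show n - 1 - k = n - (k + 1) by omega]
      ring
  · ext p
    rw [rotMap_apply, rotMap_gridPt x (Nat.sub_le _ _) (Nat.sub_le _ _),
      Nat.sub_sub_self (Nat.le_of_lt_succ p.1.2), Nat.sub_sub_self (Nat.le_of_lt_succ p.2.2),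
      gridPt_val]
    ring

theorem flipEquiv_mem : flipEquiv m m ∈ (isIrredundant_gridIneq m m).facetHom.range := by
  refine (isIrredundant_gridIneq m m).mem_range_facetHom (flipMap m) _
    (fun e => Subtype.ext (flip_flip e.1)) (fun e x => ?_) fun x => ?_
  · obtain ⟨e, he⟩ := e
    change gridSlack m m e _ = gridSlack m m e.flip x
    cases e <;> simp only [GridEdge.flip, gridSlack_bot, gridSlack_top, gridSlack_hor,
      gridSlack_ver, flipMap_gridPt] <;> ring
  · ext p
    change 1 - (1 - x p) = x p
    ring

/-- The entry at `(0, 0)` has exactly one lower neighbour `(0, 1)` and one upper neighbour `(1, 0)`,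
so reflecting it in their midpoint exchanges its two slacks and touches no others. -/
theorem cornerSwap_mem (hm : 0 < m) (hn : 0 < n) :
    cornerSwap hm hn ∈ (isIrredundant_gridIneq m n).facetHom.range := by
  have hm' : 1 ≤ m := hm
  have hn' : 1 ≤ n := hn
  refine (isIrredundant_gridIneq m n).mem_range_facetHom (cornerMap m n) _
    (fun e => Equiv.swap_apply_self _ _ e) (fun e x => ?_) fun x => ?_
  · obtain ⟨e, he⟩ := e
    cases e with
    | bot =>
      rw [cornerSwap,
        Equiv.swap_apply_of_ne_of_ne (Edges.ne_of_val_ne (by simp)) (Edges.ne_of_val_ne (by simp))]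
      simp only [gridIneq, gridSlack_bot]
      rw [cornerMap_gridPt x (Nat.zero_le _) le_rfl, if_neg (by omega)]
    | top =>
      rw [cornerSwap,
        Equiv.swap_apply_of_ne_of_ne (Edges.ne_of_val_ne (by simp)) (Edges.ne_of_val_ne (by simp))]
      simp only [gridIneq, gridSlack_top]
      rw [cornerMap_gridPt x le_rfl (Nat.zero_le _), if_neg (by omega)]
    | hor i k =>
      have hi : i + 1 ≤ m := he.1
      by_cases h : i = 0 ∧ k = 0
      · obtain ⟨rfl, rfl⟩ := h
        rw [cornerSwap,
        Equiv.swap_apply_left]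
        simp only [gridIneq, gridSlack_hor, gridSlack_ver]
        rw [cornerMap_gridPt x hi he.2, cornerMap_gridPt x (by omega) he.2, if_neg (by omega),
          if_pos ⟨rfl, rfl⟩]
        ring_nf
      · rw [cornerSwap,
        Equiv.swap_apply_of_ne_of_ne (Edges.ne_of_val_ne (by simpa using h)) (Edges.ne_of_val_ne (by simp))]
        simp only [gridIneq, gridSlack_hor]
        rw [cornerMap_gridPt x hi he.2, cornerMap_gridPt x (by omega) he.2, if_neg (by omega),
          if_neg h]
    | ver i k =>
      have hk : k + 1 ≤ n := he.2
      by_cases h : i = 0 ∧ k = 0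
      · obtain ⟨rfl, rfl⟩ := h
        rw [cornerSwap,
        Equiv.swap_apply_right]
        simp only [gridIneq, gridSlack_hor, gridSlack_ver]
        rw [cornerMap_gridPt x he.1 hk, cornerMap_gridPt x he.1 (by omega), if_pos ⟨rfl, rfl⟩,
          if_neg (by omega)]
        ring_nf
      · rw [cornerSwap,
        Equiv.swap_apply_of_ne_of_ne (Edges.ne_of_val_ne (by simp)) (Edges.ne_of_val_ne (by simpa using h))]
        simp only [gridIneq, gridSlack_ver]
        rw [cornerMap_gridPt x he.1 hk, cornerMap_gridPt x he.1 (by omega), if_neg h,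
          if_neg (by omega)]
  · ext p
    have h1 : cornerMap m n x (gridPt m n 0 1) = x (gridPt m n 0 1) := by
      rw [cornerMap_gridPt x (Nat.zero_le _) hn', if_neg (by omega)]
    have h2 : cornerMap m n x (gridPt m n 1 0) = x (gridPt m n 1 0) := by
      rw [cornerMap_gridPt x hm' (Nat.zero_le _), if_neg (by omega)]
    rw [cornerMap_apply, h1, h2, cornerMap_apply]
    split_ifs <;> ring

end Symmetries

/-! ### Rigidity of the square structure on the edges of a grid -/

namespace GridEdge

/-- `e` and `f` are the incoming or the outgoing edges of a unit square. -/
def Partner (m n : ℕ) (e f : GridEdge) : Prop := ∃ g, g.Valid m n ∧ Opp m n e f g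

theorem opp_in_iff {m n i k : ℕ} {g : GridEdge} : Opp m n (ver i k) (hor i k) g ↔
    i < m ∧ k < n ∧ (g = ver (i + 1) k ∨ g = hor i (k + 1)) := by
  constructor
  · rintro ⟨j, l, hj, hl, h⟩
    simp only [ver.injEq, hor.injEq, reduceCtorEq, false_and, or_false] at h
    rcases h with ⟨⟨⟨rfl, rfl⟩, -⟩, hg⟩ | ⟨h, -⟩
    · exact ⟨hj, hl, hg⟩
    · omega
  · rintro ⟨hi, hk, hg⟩
    exact ⟨i, k, hi, hk, Or.inl ⟨Or.inl ⟨rfl, rfl⟩, hg⟩⟩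

/-- An edge bounds at most two squares and has one partner in each. The bounds decide which partners
exist, and this detects the border of the grid. -/
theorem partner_hor {m n i k : ℕ} {f : GridEdge} : Partner m n (hor i k) f ↔
    (i < m ∧ k < n ∧ f = ver i k) ∨ (∃ l, k = l + 1 ∧ i < m ∧ l < n ∧ f = ver (i + 1) l) := by
  constructor
  · rintro ⟨g, -, j, l, hj, hl, h⟩
    simp only [hor.injEq, reduceCtorEq, false_and, false_or] at h
    rcases h with ⟨⟨⟨rfl, rfl⟩, rfl⟩, -⟩ | ⟨⟨⟨rfl, rfl⟩, rfl⟩, -⟩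
    · exact Or.inl ⟨hj, hl, rfl⟩
    · exact Or.inr ⟨l, rfl, hj, hl, rfl⟩
  · rintro (⟨hi, hk, rfl⟩ | ⟨l, rfl, hi, hl, rfl⟩)
    · exact ⟨hor i (k + 1), ⟨hi, hk⟩, i, k, hi, hk, Or.inl ⟨Or.inr ⟨rfl, rfl⟩, Or.inr rfl⟩⟩
    · exact ⟨hor i l, ⟨hi, hl.le⟩, i, l, hi, hl, Or.inr ⟨Or.inr ⟨rfl, rfl⟩, Or.inr rfl⟩⟩

theorem partner_ver {m n i k : ℕ} {f : GridEdge} : Partner m n (ver i k) f ↔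
    (i < m ∧ k < n ∧ f = hor i k) ∨ (∃ j, i = j + 1 ∧ j < m ∧ k < n ∧ f = hor j (k + 1)) := by
  constructor
  · rintro ⟨g, -, j, l, hj, hl, h⟩
    simp only [ver.injEq, reduceCtorEq, false_and, or_false] at h
    rcases h with ⟨⟨⟨rfl, rfl⟩, rfl⟩, -⟩ | ⟨⟨⟨rfl, rfl⟩, rfl⟩, -⟩
    · exact Or.inl ⟨hj, hl, rfl⟩
    · exact Or.inr ⟨j, rfl, hj, hl, rfl⟩
  · rintro (⟨hi, hk, rfl⟩ | ⟨j, rfl, hi, hk, rfl⟩)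
    · exact ⟨hor i (k + 1), ⟨hi, hk⟩, i, k, hi, hk, Or.inl ⟨Or.inl ⟨rfl, rfl⟩, Or.inr rfl⟩⟩
    · exact ⟨hor j k, ⟨hi, hk.le⟩, j, k, hi, hk, Or.inr ⟨Or.inl ⟨rfl, rfl⟩, Or.inr rfl⟩⟩

theorem not_partner_bot {m n : ℕ} {f : GridEdge} : ¬ Partner m n bot f := by
  rintro ⟨g, -, j, l, hj, hl, h⟩
  simp at h

theorem not_partner_top {m n : ℕ} {f : GridEdge} : ¬ Partner m n top f := by
  rintro ⟨g, -, j, l, hj, hl, h⟩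
  simp at h

theorem exists_partner_hor {m n i k : ℕ} (hn : 0 < n) (h : (hor i k).Valid m n) :
    ∃ f, f.Valid m n ∧ Partner m n (hor i k) f := by
  obtain ⟨hi, hk⟩ := h
  rcases hk.eq_or_lt with rfl | hk
  · exact ⟨ver (i + 1) (k - 1), ⟨hi, by omega⟩,
      partner_hor.2 (Or.inr ⟨k - 1, by omega, hi, by omega, rfl⟩)⟩
  · exact ⟨ver i k, ⟨hi.le, hk⟩, partner_hor.2 (Or.inl ⟨hi, hk, rfl⟩)⟩

theorem exists_partner_ver {m n i k : ℕ} (hm : 0 < m) (h : (ver i k).Valid m n) :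
    ∃ f, f.Valid m n ∧ Partner m n (ver i k) f := by
  obtain ⟨hi, hk⟩ := h
  rcases hi.eq_or_lt with rfl | hi
  · exact ⟨hor (i - 1) (k + 1), ⟨by omega, hk⟩,
      partner_ver.2 (Or.inr ⟨i - 1, by omega, by omega, hk, rfl⟩)⟩
  · exact ⟨hor i k, ⟨hi, hk.le⟩, partner_ver.2 (Or.inl ⟨hi, hk, rfl⟩)⟩

/-- A bijection between the edges of two grids respecting the squares. -/
structure IsGridIso (m n m' n' : ℕ) (s : GridEdge → GridEdge) : Prop where
  valid : ∀ {e}, e.Valid m n → (s e).Valid m' n'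
  inj : ∀ {e f}, e.Valid m n → f.Valid m n → s e = s f → e = f
  surj : ∀ {e'}, e'.Valid m' n' → ∃ e, e.Valid m n ∧ s e = e'
  opp : ∀ {e f g}, e.Valid m n → f.Valid m n → g.Valid m n →
    (Opp m' n' (s e) (s f) (s g) ↔ Opp m n e f g)

/-! ### Propagation from the first square -/

namespace IsGridIso

variable {m n m' n' : ℕ} {s : GridEdge → GridEdge}

theorem partner (h : IsGridIso m n m' n' s) {e f : GridEdge} (he : e.Valid m n)
    (hf : f.Valid m n) : Partner m' n' (s e) (s f) ↔ Partner m n e f := by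
  constructor
  · rintro ⟨g', hg', ho⟩
    obtain ⟨g, hg, rfl⟩ := h.surj hg'
    exact ⟨g, hg, (h.opp he hf hg).1 ho⟩
  · rintro ⟨g, hg, ho⟩
    exact ⟨s g, h.valid hg, (h.opp he hf hg).2 ho⟩

/-- If the incoming edges of a square are fixed, then the outgoing ones are fixed or exchanged. -/
theorem out_of_in (h : IsGridIso m n m' n' s) {i k : ℕ} (hi : i < m) (hk : k < n)
    (hv : s (ver i k) = ver i k) (hh : s (hor i k) = hor i k) :
    i < m' ∧ k < n' ∧
      ((s (ver (i + 1) k) = ver (i + 1) k ∧ s (hor i (k + 1)) = hor i (k + 1)) ∨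
        (s (ver (i + 1) k) = hor i (k + 1) ∧ s (hor i (k + 1)) = ver (i + 1) k)) := by
  have vv : (ver i k).Valid m n := ⟨hi.le, hk⟩
  have vh : (hor i k).Valid m n := ⟨hi, hk.le⟩
  have vv' : (ver (i + 1) k).Valid m n := ⟨hi, hk⟩
  have vh' : (hor i (k + 1)).Valid m n := ⟨hi, hk⟩
  have h1 := (h.opp vv vh vv').2 (opp_in_iff.2 ⟨hi, hk, Or.inl rfl⟩)
  have h2 := (h.opp vv vh vh').2 (opp_in_iff.2 ⟨hi, hk, Or.inr rfl⟩)
  rw [hv, hh, opp_in_iff] at h1 h2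
  refine ⟨h1.1, h1.2.1, ?_⟩
  have hne : s (ver (i + 1) k) ≠ s (hor i (k + 1)) := fun he => by
    simpa using h.inj vv' vh' he
  rcases h1.2.2 with h1 | h1 <;> rcases h2.2.2 with h2 | h2 <;> rw [h1, h2] at hne <;> simp_all

/-- All edges at distance `d` from the corner are fixed. -/
def FixesLevel (m n : ℕ) (s : GridEdge → GridEdge) (d : ℕ) : Prop :=
  ∀ i k, i + k = d → (i < m → k ≤ n → s (hor i k) = hor i k) ∧
    (i ≤ m → k < n → s (ver i k) = ver i k)

/-- The outgoing edges of all squares at distance `d` from the corner are fixed. -/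
def FixesOut (m n : ℕ) (s : GridEdge → GridEdge) (d : ℕ) : Prop :=
  ∀ i k, i + k = d → i < m → k < n →
    s (ver (i + 1) k) = ver (i + 1) k ∧ s (hor i (k + 1)) = hor i (k + 1)

/-- Every edge of level `d + 1` leaves a square of level `d`, except `hor (d + 1) 0` and `ver 0 (d +
1)`. Each of these is a partner of a fixed edge whose only other partner is already an image. -/
theorem fixesLevel_succ (h : IsGridIso m n m' n' s) {d : ℕ} (hm : 0 < m) (hn : 0 < n)
    (hout : FixesOut m n s d) : FixesLevel m n s (d + 1) := by
  intro i k hd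
  constructor
  · intro hi hk
    obtain _ | k := k
    · obtain rfl : i = d + 1 := by omega
      obtain ⟨h1, h2⟩ := hout d 0 rfl (by omega) hn
      have hp := (h.partner (e := ver (d + 1) 0) (f := hor (d + 1) 0) ⟨hi.le, hn⟩ ⟨hi, hk⟩).2
        (partner_ver.2 (Or.inl ⟨hi, hn, rfl⟩))
      rw [h1, partner_ver] at hp
      rcases hp with ⟨-, -, hp⟩ | ⟨j, hj, -, -, hp⟩
      · exact hp
      · obtain rfl : j = d := by omega
        rw [← h2] at hp
        simpa using h.inj (e := hor (j + 1) 0) (f := hor j 1) ⟨hi, hk⟩ ⟨by omega, hn⟩ hp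
    · exact (hout i k (by omega) hi hk).2
  · intro hi hk
    obtain _ | i := i
    · obtain rfl : k = d + 1 := by omega
      obtain ⟨h1, h2⟩ := hout 0 d (by omega) hm (by omega)
      have hp := (h.partner (e := hor 0 (d + 1)) (f := ver 0 (d + 1)) ⟨hm, hk.le⟩ ⟨hi, hk⟩).2
        (partner_hor.2 (Or.inl ⟨hm, hk, rfl⟩))
      rw [h2, partner_hor] at hp
      rcases hp with ⟨-, -, hp⟩ | ⟨j, hj, -, -, hp⟩
      · exact hp
      · obtain rfl : j = d := by omega
        rw [zero_add] at hp h1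
        rw [← h1] at hp
        simpa using h.inj (e := ver 0 (j + 1)) (f := ver 1 j) ⟨hi, hk⟩ ⟨hm, by omega⟩ hp
    · exact (hout i k (by omega) hi hk).1

/-- An exchange in one square conflicts with a neighbouring square of the same level, through the
partnership of edges leaving both. Grids of width one have no such neighbour and need a separate
argument. The last square is excluded by `hdm`, as its exchange is a genuine symmetry. -/
theorem fixesOut (h : IsGridIso m n m' n' s) {d : ℕ} (hd : 0 < d) (hdm : d + 2 < m + n)
    (hl : FixesLevel m n s d) : FixesOut m n s d := by
  intro i k hik hi hk
  have out : ∀ i k, i + k = d → i < m → k < n → _ := fun i k hik hi hk =>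
    h.out_of_in hi hk ((hl i k hik).2 hi.le hk) ((hl i k hik).1 hi hk.le)
  obtain ⟨-, -, hfix | ⟨h1, h2⟩⟩ := out i k hik hi hk
  · exact hfix
  exfalso
  -- The neighbour `(i + 1, k - 1)` sends its outgoing horizontal edge to an edge that is not a
  -- partner of `hor i (k + 1)`.
  by_cases c1 : 1 ≤ k ∧ i + 1 < m
  · obtain ⟨l, rfl⟩ : ∃ l, k = l + 1 := ⟨k - 1, by omega⟩
    obtain ⟨-, -, h3⟩ := out (i + 1) l (by omega) c1.2 (by omega)
    have hp := (h.partner (e := ver (i + 1) (l + 1)) (f := hor (i + 1) (l + 1)) ⟨hi, hk⟩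
      ⟨c1.2, hk.le⟩).2 (partner_ver.2 (Or.inl ⟨c1.2, hk, rfl⟩))
    rw [h1, partner_hor] at hp
    rcases h3 with ⟨-, h3⟩ | ⟨-, h3⟩ <;> rw [h3] at hp <;> simp at hp
    omega
  by_cases c2 : 1 ≤ i ∧ k + 1 < n
  · obtain ⟨j, rfl⟩ : ∃ j, i = j + 1 := ⟨i - 1, by omega⟩
    obtain ⟨-, -, h3⟩ := out j (k + 1) (by omega) (by omega) c2.2
    have hp := (h.partner (e := hor (j + 1) (k + 1)) (f := ver (j + 1) (k + 1)) ⟨hi, hk⟩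
      ⟨hi.le, c2.2⟩).2 (partner_hor.2 (Or.inl ⟨hi, c2.2, rfl⟩))
    rw [h2, partner_ver] at hp
    rcases h3 with ⟨h3, -⟩ | ⟨h3, -⟩ <;> rw [h3] at hp <;> simp at hp
    omega
  -- Without neighbours, and away from the last square, the grid is a single strip.
  by_cases c3 : 1 ≤ k
  · obtain rfl : i = 0 := by omega
    obtain rfl : m = 1 := by omega
    obtain ⟨l, rfl⟩ : ∃ l, k = l + 1 := ⟨k - 1, by omega⟩
    have hk2 : l + 2 < n := by omega
    have hfv := (hl 1 l (by omega)).2 le_rfl (by omega)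
    have hfh := (hl 0 (l + 1) (by omega)).1 hi hk.le
    -- In a wider target, `ver 1 l` would acquire the second partner `hor 1 l`, although its only
    -- partner in the source is fixed.
    have hm' : ¬ 1 < m' := by
      intro hm'
      have hn' : l < n' := by
        have := h.valid (e := ver 1 l) ⟨le_rfl, by omega⟩
        rw [hfv] at this
        exact this.2
      obtain ⟨f, hf, hfe⟩ := h.surj (e' := hor 1 l) ⟨hm', hn'.le⟩
      have hp : Partner m' n' (s (ver 1 l)) (s f) := by
        rw [hfv, hfe]
        exact partner_ver.2 (Or.inl ⟨hm', hn', rfl⟩)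
      rw [h.partner (e := ver 1 l) ⟨le_rfl, by omega⟩ hf, partner_ver] at hp
      rcases hp with ⟨hp, -⟩ | ⟨j, hj, -, -, rfl⟩
      · omega
      · obtain rfl : j = 0 := by omega
        rw [hfh] at hfe
        simp at hfe
    have hp := (h.partner (e := hor 0 (l + 2)) (f := ver 0 (l + 2)) ⟨hi, hk2.le⟩
      ⟨by omega, hk2⟩).2 (partner_hor.2 (Or.inl ⟨hi, hk2, rfl⟩))
    rw [h2, partner_ver] at hp
    rcases hp with ⟨hp, -⟩ | ⟨j, hj, -, -, hp⟩
    · omega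
    · obtain rfl : j = 0 := by omega
      rw [← h1] at hp
      simpa using h.inj (e := ver 0 (l + 2)) (f := ver 1 (l + 1)) ⟨by omega, hk2⟩ ⟨le_rfl, hk⟩ hp
  · obtain rfl : k = 0 := by omega
    obtain rfl : n = 1 := by omega
    obtain ⟨j, rfl⟩ : ∃ j, i = j + 1 := ⟨i - 1, by omega⟩
    have hi2 : j + 2 < m := by omega
    have hfh := (hl j 1 (by omega)).1 (by omega) le_rfl
    have hfv := (hl (j + 1) 0 (by omega)).2 hi.le hk
    have hn' : ¬ 1 < n' := by
      intro hn'
      have hm' : j < m' := by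
        have := h.valid (e := hor j 1) ⟨by omega, le_rfl⟩
        rw [hfh] at this
        exact this.1
      obtain ⟨f, hf, hfe⟩ := h.surj (e' := ver j 1) ⟨hm'.le, hn'⟩
      have hp : Partner m' n' (s (hor j 1)) (s f) := by
        rw [hfh, hfe]
        exact partner_hor.2 (Or.inl ⟨hm', hn', rfl⟩)
      rw [h.partner (e := hor j 1) ⟨by omega, le_rfl⟩ hf, partner_hor] at hp
      rcases hp with ⟨-, hp, -⟩ | ⟨l, hl, -, -, rfl⟩
      · omega
      · obtain rfl : l = 0 := by omega
        rw [hfv] at hfe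
        simp at hfe
    have hp := (h.partner (e := ver (j + 2) 0) (f := hor (j + 2) 0) ⟨hi2.le, hk⟩
      ⟨hi2, by omega⟩).2 (partner_ver.2 (Or.inl ⟨hi2, hk, rfl⟩))
    rw [h1, partner_hor] at hp
    rcases hp with ⟨-, hp, -⟩ | ⟨l, hl, -, -, hp⟩
    · omega
    · obtain rfl : l = 0 := by omega
      rw [← h2] at hp
      simpa using h.inj (e := hor (j + 2) 0) (f := hor (j + 1) 1) ⟨hi2, by omega⟩ ⟨hi, le_rfl⟩ hp

/-- An isomorphism fixing the edges of the first square fixes all edges but the last two. -/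
theorem fixesLevel (h : IsGridIso m n m' n' s) (hm : 0 < m) (hn : 0 < n)
    (h1 : s (ver 0 0) = ver 0 0) (h2 : s (hor 0 0) = hor 0 0) (h3 : s (ver 1 0) = ver 1 0)
    (h4 : s (hor 0 1) = hor 0 1) {d : ℕ} (hd : d + 2 ≤ m + n) : FixesLevel m n s d := by
  induction d with
  | zero =>
    intro i k hik
    obtain ⟨rfl, rfl⟩ : i = 0 ∧ k = 0 := by omega
    exact ⟨fun _ _ => h2, fun _ _ => h1⟩
  | succ d ih =>
    refine h.fixesLevel_succ hm hn ?_
    obtain rfl | hd0 := Nat.eq_zero_or_pos d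
    · intro i k hik _ _
      obtain ⟨rfl, rfl⟩ : i = 0 ∧ k = 0 := by omega
      exact ⟨h3, h4⟩
    · exact h.fixesOut hd0 (by omega) (ih (by omega))

/-- The incoming edges of the last square are fixed, so that square is also present in the target.
Keeping the target grid arbitrary allows comparison with the transposed grid. -/
theorem size_le (h : IsGridIso m n m' n' s) (hm : 0 < m) (hn : 0 < n)
    (h1 : s (ver 0 0) = ver 0 0) (h2 : s (hor 0 0) = hor 0 0) (h3 : s (ver 1 0) = ver 1 0)
    (h4 : s (hor 0 1) = hor 0 1) : m ≤ m' ∧ n ≤ n' := by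
  have hl := h.fixesLevel hm hn h1 h2 h3 h4 (d := m + n - 2) (by omega) (m - 1) (n - 1) (by omega)
  have := h.out_of_in (i := m - 1) (k := n - 1) (by omega) (by omega) (hl.2 (by omega) (by omega))
    (hl.1 (by omega) (by omega))
  omega

/-- The last two edges are fixed or exchanged. -/
theorem last_pair (h : IsGridIso m n m' n' s) (hm : 0 < m) (hn : 0 < n)
    (h1 : s (ver 0 0) = ver 0 0) (h2 : s (hor 0 0) = hor 0 0) (h3 : s (ver 1 0) = ver 1 0)
    (h4 : s (hor 0 1) = hor 0 1) :
    (s (ver m (n - 1)) = ver m (n - 1) ∧ s (hor (m - 1) n) = hor (m - 1) n) ∨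
      (s (ver m (n - 1)) = hor (m - 1) n ∧ s (hor (m - 1) n) = ver m (n - 1)) := by
  have hl := h.fixesLevel hm hn h1 h2 h3 h4 (d := m + n - 2) (by omega) (m - 1) (n - 1) (by omega)
  have := (h.out_of_in (i := m - 1) (k := n - 1) (by omega) (by omega)
    (hl.2 (by omega) (by omega)) (hl.1 (by omega) (by omega))).2.2
  rwa [Nat.sub_add_cancel hm, Nat.sub_add_cancel hn] at this

/-- The image of the first pair of edges. -/
theorem first_pair (h : IsGridIso m n m' n' s) (hm : 0 < m) (hn : 0 < n) :
    (s (ver 0 0) = ver 0 0 ∧ s (hor 0 0) = hor 0 0) ∨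
      (s (ver 0 0) = hor 0 0 ∧ s (hor 0 0) = ver 0 0) ∨
      (s (ver 0 0) = ver m' (n' - 1) ∧ s (hor 0 0) = hor (m' - 1) n') ∨
      (s (ver 0 0) = hor (m' - 1) n' ∧ s (hor 0 0) = ver m' (n' - 1)) := by
  have vv : (ver 0 0).Valid m n := ⟨hm.le, hn⟩
  have vh : (hor 0 0).Valid m n := ⟨hm, hn.le⟩
  have hp := (h.partner vv vh).2 (partner_ver.2 (Or.inl ⟨hm, hn, rfl⟩))
  -- The edges of the first pair are each other's only partners; `main` and `main'` show that only
  -- the pairs at `(0, 0)` and `(m', n')` have this property.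
  have uv : ∀ f, f.Valid m' n' → Partner m' n' (s (ver 0 0)) f → f = s (hor 0 0) := by
    intro f hf hpf
    obtain ⟨f, hf', rfl⟩ := h.surj hf
    rw [h.partner vv hf', partner_ver] at hpf
    rcases hpf with ⟨-, -, rfl⟩ | ⟨j, hj, -⟩
    · rfl
    · omega
  have uh : ∀ f, f.Valid m' n' → Partner m' n' (s (hor 0 0)) f → f = s (ver 0 0) := by
    intro f hf hpf
    obtain ⟨f, hf', rfl⟩ := h.surj hf
    rw [h.partner vh hf', partner_hor] at hpf
    rcases hpf with ⟨-, -, rfl⟩ | ⟨j, hj, -⟩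
    · rfl
    · omega
  have main : ∀ (e f : GridEdge) (i k : ℕ), i < m' → k < n' → e = ver i k → f = hor i k →
      (∀ x, x.Valid m' n' → Partner m' n' e x → x = f) →
      (∀ x, x.Valid m' n' → Partner m' n' f x → x = e) → e = ver 0 0 ∧ f = hor 0 0 := by
    rintro _ _ i k hi hk rfl rfl u1 u2
    have hi0 : i = 0 := by
      by_contra hne
      have := u1 (hor (i - 1) (k + 1)) ⟨by omega, hk⟩
        (partner_ver.2 (Or.inr ⟨i - 1, by omega, by omega, hk, rfl⟩))
      simp at this
    have hk0 : k = 0 := by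
      by_contra hne
      have := u2 (ver (i + 1) (k - 1)) ⟨hi, by omega⟩
        (partner_hor.2 (Or.inr ⟨k - 1, by omega, hi, by omega, rfl⟩))
      simp at this
    subst hi0 hk0
    exact ⟨rfl, rfl⟩
  have main' : ∀ (e f : GridEdge) (i k : ℕ), i < m' → k < n' → e = ver (i + 1) k →
      f = hor i (k + 1) →
      (∀ x, x.Valid m' n' → Partner m' n' e x → x = f) →
      (∀ x, x.Valid m' n' → Partner m' n' f x → x = e) →
      e = ver m' (n' - 1) ∧ f = hor (m' - 1) n' := by
    rintro _ _ i k hi hk rfl rfl u1 u2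
    have hi0 : i + 1 = m' := by
      by_contra hne
      have := u1 (hor (i + 1) k) ⟨by omega, hk.le⟩
        (partner_ver.2 (Or.inl ⟨by omega, hk, rfl⟩))
      simp at this
    have hk0 : k + 1 = n' := by
      by_contra hne
      have := u2 (ver i (k + 1)) ⟨hi.le, by omega⟩
        (partner_hor.2 (Or.inl ⟨hi, by omega, rfl⟩))
      simp at this
    subst hi0 hk0
    exact ⟨rfl, rfl⟩
  obtain ⟨g, -, i, k, hi, hk, ho⟩ := hp
  rcases ho with ⟨⟨he, hf⟩ | ⟨he, hf⟩, -⟩ | ⟨⟨he, hf⟩ | ⟨he, hf⟩, -⟩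
  · exact Or.inl (main _ _ i k hi hk he hf uv uh)
  · exact Or.inr (Or.inl (main _ _ i k hi hk hf he uh uv).symm)
  · exact Or.inr (Or.inr (Or.inl (main' _ _ i k hi hk he hf uv uh)))
  · exact Or.inr (Or.inr (Or.inr (main' _ _ i k hi hk hf he uh uv).symm))

/-- Every grid edge bounds a square and so has a partner; only `bot` and `top` have none. -/
theorem mem_unbounded (h : IsGridIso m n m' n' s) (hm' : 0 < m') (hn' : 0 < n') {e : GridEdge}
    (hv : e.Valid m n) (he : ∀ f, ¬ Partner m n e f) : s e = bot ∨ s e = top := by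
  have hv' := h.valid hv
  have key : ¬ ∃ f, f.Valid m' n' ∧ Partner m' n' (s e) f := by
    rintro ⟨f, hf, hp⟩
    obtain ⟨f, hf', rfl⟩ := h.surj hf
    exact he f ((h.partner hv hf').1 hp)
  cases hs : s e with
  | bot => exact Or.inl rfl
  | top => exact Or.inr rfl
  | hor i k => rw [hs] at hv' key; exact absurd (exists_partner_hor hn' hv') key
  | ver i k => rw [hs] at hv' key; exact absurd (exists_partner_ver hm' hv') key

end IsGridIso

end GridEdge

/-! ### Automorphisms of the square structure -/

section Automorphisms

variable {m n m' n' m'' n'' : ℕ}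

/-- The bijection of edges respects the unit squares. -/
def RespectsSquares (σ : Edges m n ≃ Edges m' n') : Prop :=
  ∀ e f g, Opp m' n' (σ e).1 (σ f).1 (σ g).1 ↔ Opp m n e.1 f.1 g.1

theorem RespectsSquares.trans {σ : Edges m n ≃ Edges m' n'} {τ : Edges m' n' ≃ Edges m'' n''}
    (hσ : RespectsSquares σ) (hτ : RespectsSquares τ) : RespectsSquares (σ.trans τ) :=
  fun e f g => (hτ (σ e) (σ f) (σ g)).trans (hσ e f g)

theorem GridEdge.Opp.flip {e f g : GridEdge} (h : Opp m n e f g) :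
    Opp n m e.flip f.flip g.flip := by
  obtain ⟨i, k, hi, hk, h⟩ := h
  refine ⟨k, i, hk, hi, ?_⟩
  rcases h with ⟨⟨rfl, rfl⟩ | ⟨rfl, rfl⟩, rfl | rfl⟩ | ⟨⟨rfl, rfl⟩ | ⟨rfl, rfl⟩, rfl | rfl⟩ <;>
    simp [GridEdge.flip]

theorem respectsSquares_flipEquiv : RespectsSquares (flipEquiv m n) := fun e f g =>
  ⟨fun h => by simpa [flipEquiv, GridEdge.flip_flip] using Opp.flip h, fun h => Opp.flip h⟩

theorem GridEdge.Opp.ne {e f g : GridEdge} (h : Opp m n e f g) : g ≠ e ∧ g ≠ f := by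
  obtain ⟨i, k, hi, hk, h⟩ := h
  rcases h with ⟨⟨rfl, rfl⟩ | ⟨rfl, rfl⟩, rfl | rfl⟩ | ⟨⟨rfl, rfl⟩ | ⟨rfl, rfl⟩, rfl | rfl⟩ <;>
    simp

/-- The trivial implications `g = e` and `g = f` are preserved by any bijection, and `Opp` excludes
them, so invariance of `TightImp` leaves invariance of `Opp`. -/
theorem respectsSquares_of_mem {σ : Equiv.Perm (Edges m n)}
    (hσ : σ ∈ (isIrredundant_gridIneq m n).facetHom.range) : RespectsSquares σ := by
  obtain ⟨φ, rfl⟩ := hσ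
  intro e f g
  have key := (isIrredundant_gridIneq m n).tightImp_facetHom φ e f g
  rw [tightImp_grid_iff, tightImp_grid_iff, EmbeddingLike.apply_eq_iff_eq,
    EmbeddingLike.apply_eq_iff_eq] at key
  constructor <;> intro h
  · rcases key.1 (Or.inr (Or.inr h)) with rfl | rfl | h'
    · exact absurd rfl h.ne.1
    · exact absurd rfl h.ne.2
    · exact h'
  · rcases key.2 (Or.inr (Or.inr h)) with rfl | rfl | h'
    · exact absurd rfl h.ne.1
    · exact absurd rfl h.ne.2
    · exact h'

open Classical in
/-- Extension of a map of edges by the identity. -/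
noncomputable def edgeMap (σ : Edges m n ≃ Edges m' n') (e : GridEdge) : GridEdge :=
  if h : e.Valid m n then (σ ⟨e, h⟩).1 else e

theorem edgeMap_of_valid (σ : Edges m n ≃ Edges m' n') {e : GridEdge} (h : e.Valid m n) :
    edgeMap σ e = (σ ⟨e, h⟩).1 := dif_pos h

theorem RespectsSquares.isGridIso {σ : Edges m n ≃ Edges m' n'} (hσ : RespectsSquares σ) :
    IsGridIso m n m' n' (edgeMap σ) where
  valid h := by rw [edgeMap_of_valid σ h]; exact (σ _).2
  inj he hf h := by
    rw [edgeMap_of_valid σ he, edgeMap_of_valid σ hf] at h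
    exact congrArg Subtype.val (σ.injective (Subtype.ext h))
  surj {e'} he' := by
    refine ⟨(σ.symm ⟨e', he'⟩).1, (σ.symm ⟨e', he'⟩).2, ?_⟩
    rw [edgeMap_of_valid σ (σ.symm ⟨e', he'⟩).2]
    simp
  opp he hf hg := by
    rw [edgeMap_of_valid σ he, edgeMap_of_valid σ hf, edgeMap_of_valid σ hg]
    exact hσ _ _ _

theorem edgeMap_trans (σ : Edges m n ≃ Edges m' n') (τ : Edges m' n' ≃ Edges m'' n'')
    {e : GridEdge} (h : e.Valid m n) : edgeMap (σ.trans τ) e = edgeMap τ (edgeMap σ e) := by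
  rw [edgeMap_of_valid _ h, edgeMap_of_valid σ h, edgeMap_of_valid τ (σ _).2]
  rfl

theorem edgeMap_mul (σ τ : Equiv.Perm (Edges m n)) {e : GridEdge} (h : e.Valid m n) :
    edgeMap (σ * τ) e = edgeMap σ (edgeMap τ e) :=
  edgeMap_trans τ σ h

theorem edgeMap_swap (a b : Edges m n) {e : GridEdge} (h : e.Valid m n) :
    edgeMap (Equiv.swap a b) e = Equiv.swap a.1 b.1 e := by
  rw [edgeMap_of_valid _ h, Equiv.swap_apply_def, Equiv.swap_apply_def]
  simp only [Subtype.ext_iff]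
  split_ifs <;> rfl

theorem perm_ext_edgeMap {σ τ : Equiv.Perm (Edges m n)}
    (h : ∀ e : GridEdge, e.Valid m n → edgeMap σ e = edgeMap τ e) : σ = τ :=
  Equiv.ext fun e => Subtype.ext (by
    have := h e.1 e.2
    rwa [edgeMap_of_valid σ e.2, edgeMap_of_valid τ e.2] at this)

/-- Exchange of the two edges at the corner `(m, n)`. -/
def lastSwap (hm : 0 < m) (hn : 0 < n) : Equiv.Perm (Edges m n) :=
  Equiv.swap ⟨hor (m - 1) n, Nat.sub_lt hm one_pos, le_rfl⟩
    ⟨ver m (n - 1), le_rfl, Nat.sub_lt hn one_pos⟩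

theorem rotPerm_mul_self : rotPerm m n * rotPerm m n = 1 :=
  Equiv.ext fun e => Subtype.ext e.2.rot_rot

theorem rotPerm_conj_cornerSwap (hm : 0 < m) (hn : 0 < n) :
    rotPerm m n * cornerSwap hm hn * rotPerm m n = lastSwap hm hn := by
  rw [cornerSwap, Equiv.mul_swap_eq_swap_mul, mul_assoc, rotPerm_mul_self, mul_one]
  rfl

variable (hm : 0 < m) (hn : 0 < n) {H : Subgroup (Equiv.Perm (Edges m n))}

include hm hn in
-- All grid edges are fixed, so only `bot` and `top` can still move, and `σ` is the identity or the
-- apex exchange.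
theorem mem_of_fixes_all (ht : apexSwap m n ∈ H) {σ : Equiv.Perm (Edges m n)}
    (hσ : RespectsSquares σ) (h1 : edgeMap σ (ver 0 0) = ver 0 0)
    (h2 : edgeMap σ (hor 0 0) = hor 0 0) (h3 : edgeMap σ (ver 1 0) = ver 1 0)
    (h4 : edgeMap σ (hor 0 1) = hor 0 1) (h5 : edgeMap σ (ver m (n - 1)) = ver m (n - 1))
    (h6 : edgeMap σ (hor (m - 1) n) = hor (m - 1) n) : σ ∈ H := by
  have hiso := hσ.isGridIso
  have hhor : ∀ i k, (hor i k).Valid m n → edgeMap σ (hor i k) = hor i k := by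
    rintro i k ⟨hi, hk⟩
    by_cases hd : i + k + 2 ≤ m + n
    · exact (hiso.fixesLevel hm hn h1 h2 h3 h4 hd i k rfl).1 hi hk
    · obtain ⟨rfl, rfl⟩ : i = m - 1 ∧ k = n := by omega
      exact h6
  have hver : ∀ i k, (ver i k).Valid m n → edgeMap σ (ver i k) = ver i k := by
    rintro i k ⟨hi, hk⟩
    by_cases hd : i + k + 2 ≤ m + n
    · exact (hiso.fixesLevel hm hn h1 h2 h3 h4 hd i k rfl).2 hi hk
    · obtain ⟨rfl, rfl⟩ : i = m ∧ k = n - 1 := by omega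
      exact h5
  have vb : bot.Valid m n := trivial
  have vt : top.Valid m n := trivial
  have hne : edgeMap σ bot ≠ edgeMap σ top := fun h => by simpa using hiso.inj vb vt h
  have hb := hiso.mem_unbounded hm hn vb fun f => not_partner_bot
  have htop := hiso.mem_unbounded hm hn vt fun f => not_partner_top
  rcases hb with hb | hb
  · have htop : edgeMap σ top = top := htop.resolve_left (fun h => hne (hb.trans h.symm))
    have : σ = 1 := perm_ext_edgeMap fun e he => by
      rw [edgeMap_of_valid 1 he]
      cases e with
      | bot => exact hb
      | top => exact htop
      | hor i k => exact hhor i k he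
      | ver i k => exact hver i k he
    rw [this]
    exact one_mem H
  · have htop : edgeMap σ top = bot := htop.resolve_right (fun h => hne (hb.trans h.symm))
    have : σ = apexSwap m n := perm_ext_edgeMap fun e he => by
      rw [apexSwap, edgeMap_swap _ _ he]
      cases e with
      | bot => simpa using hb
      | top => simpa using htop
      | hor i k => rw [hhor i k he, Equiv.swap_apply_of_ne_of_ne] <;> simp
      | ver i k => rw [hver i k he, Equiv.swap_apply_of_ne_of_ne] <;> simp
    rw [this]
    exact ht

theorem respectsSquares_cornerSwap : RespectsSquares (cornerSwap hm hn) :=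
  respectsSquares_of_mem (cornerSwap_mem hm hn)

theorem respectsSquares_rotPerm : RespectsSquares (rotPerm m n) :=
  respectsSquares_of_mem rotPerm_mem

theorem respectsSquares_lastSwap : RespectsSquares (lastSwap hm hn) := by
  rw [← rotPerm_conj_cornerSwap]
  exact respectsSquares_of_mem (mul_mem (mul_mem rotPerm_mem (cornerSwap_mem hm hn)) rotPerm_mem)

theorem mem_of_fixes_square (ht : apexSwap m n ∈ H) (hl : lastSwap hm hn ∈ H)
    {σ : Equiv.Perm (Edges m n)} (hσ : RespectsSquares σ)
    (h1 : edgeMap σ (ver 0 0) = ver 0 0) (h2 : edgeMap σ (hor 0 0) = hor 0 0)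
    (h3 : edgeMap σ (ver 1 0) = ver 1 0) (h4 : edgeMap σ (hor 0 1) = hor 0 1) : σ ∈ H := by
  rcases hσ.isGridIso.last_pair hm hn h1 h2 h3 h4 with ⟨h5, h6⟩ | ⟨h5, h6⟩
  · exact mem_of_fixes_all hm hn ht hσ h1 h2 h3 h4 h5 h6
  -- In a single square the last pair belongs to the first square and is fixed. Otherwise `lastSwap`
  -- leaves the first square alone and undoes the exchange.
  · have hmn : ¬ (m = 1 ∧ n = 1) := by
      rintro ⟨rfl, rfl⟩
      rw [h3] at h5
      simp at h5
    refine (H.mul_mem_cancel_left hl).1 (mem_of_fixes_all hm hn ht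
      (hσ.trans (respectsSquares_lastSwap hm hn)) ?_ ?_ ?_ ?_ ?_ ?_) <;>
    rw [edgeMap_mul _ _ (by simp only [Valid]; omega)]
    · rw [h1, lastSwap, edgeMap_swap _ _ (by simp only [Valid]; omega),
        Equiv.swap_apply_of_ne_of_ne] <;> simp; omega
    · rw [h2, lastSwap, edgeMap_swap _ _ (by simp only [Valid]; omega),
        Equiv.swap_apply_of_ne_of_ne] <;> simp; omega
    · rw [h3, lastSwap, edgeMap_swap _ _ (by simp only [Valid]; omega),
        Equiv.swap_apply_of_ne_of_ne] <;> simp; omega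
    · rw [h4, lastSwap, edgeMap_swap _ _ (by simp only [Valid]; omega),
        Equiv.swap_apply_of_ne_of_ne] <;> simp; omega
    · rw [h5, lastSwap, edgeMap_swap _ _ (by simp only [Valid]; omega), Equiv.swap_apply_left]
    · rw [h6, lastSwap, edgeMap_swap _ _ (by simp only [Valid]; omega), Equiv.swap_apply_right]

theorem edgeMap_cornerSwap {e : GridEdge} (he : e.Valid m n) :
    edgeMap (cornerSwap hm hn) e = Equiv.swap (hor 0 0) (ver 0 0) e :=
  edgeMap_swap _ _ he

theorem edgeMap_flipEquiv {e : GridEdge} (he : e.Valid m n) :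
    edgeMap (flipEquiv m n) e = e.flip :=
  edgeMap_of_valid _ he

include hm hn in
/-- If the outgoing edges of the first square are exchanged, then the grid is square. -/
theorem eq_of_out_swapped {σ : Equiv.Perm (Edges m n)} (hσ : RespectsSquares σ)
    (h1 : edgeMap σ (ver 0 0) = ver 0 0) (h2 : edgeMap σ (hor 0 0) = hor 0 0)
    (h3 : edgeMap σ (ver 1 0) = hor 0 1) (h4 : edgeMap σ (hor 0 1) = ver 1 0) : m = n := by
  -- The composite maps the `n × m` grid to the `m × n` grid and fixes the first square, so
  -- `size_le` yields both `n ≤ m` and `m ≤ n`.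
  have hs : RespectsSquares (((flipEquiv n m).trans σ).trans (cornerSwap hm hn)) :=
    (respectsSquares_flipEquiv.trans hσ).trans (respectsSquares_cornerSwap hm hn)
  have key : ∀ e : GridEdge, e.Valid n m →
      edgeMap (((flipEquiv n m).trans σ).trans (cornerSwap hm hn)) e =
        Equiv.swap (hor 0 0) (ver 0 0) (edgeMap σ e.flip) := fun e he => by
    rw [edgeMap_trans _ _ he, edgeMap_trans _ _ he, edgeMap_flipEquiv he, edgeMap_cornerSwap]
    exact hσ.isGridIso.valid he.flip
  have := hs.isGridIso.size_le hn hm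
    (by rw [key (ver 0 0) ⟨Nat.zero_le _, hm⟩, GridEdge.flip, h2, Equiv.swap_apply_left])
    (by rw [key (hor 0 0) ⟨hn, Nat.zero_le _⟩, GridEdge.flip, h1, Equiv.swap_apply_right])
    (by rw [key (ver 1 0) ⟨hn, hm⟩, GridEdge.flip, h4, Equiv.swap_apply_of_ne_of_ne (by simp) (by simp)])
    (by rw [key (hor 0 1) ⟨hn, hm⟩, GridEdge.flip, h3, Equiv.swap_apply_of_ne_of_ne (by simp) (by simp)])
  omega

theorem mem_of_fixes_in (ht : apexSwap m n ∈ H) (hl : lastSwap hm hn ∈ H)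
    (hc : cornerSwap hm hn ∈ H)
    (hf : m = n → ∃ τ ∈ H, RespectsSquares τ ∧ ∀ e : GridEdge, e.Valid m n → edgeMap τ e = e.flip)
    {σ : Equiv.Perm (Edges m n)} (hσ : RespectsSquares σ)
    (h1 : edgeMap σ (ver 0 0) = ver 0 0) (h2 : edgeMap σ (hor 0 0) = hor 0 0) : σ ∈ H := by
  rcases (hσ.isGridIso.out_of_in hm hn h1 h2).2.2 with ⟨h3, h4⟩ | ⟨h3, h4⟩
  · exact mem_of_fixes_square hm hn ht hl hσ h1 h2 h3 h4
  · rw [zero_add] at h3 h4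
    obtain ⟨τ, hτ, hτs, hτf⟩ := hf (eq_of_out_swapped hm hn hσ h1 h2 h3 h4)
    have key : ∀ e : GridEdge, e.Valid m n →
        edgeMap (cornerSwap hm hn * (τ * σ)) e =
          Equiv.swap (hor 0 0) (ver 0 0) (edgeMap σ e).flip := fun e he => by
      have hv := hσ.isGridIso.valid he
      rw [edgeMap_mul _ _ he, edgeMap_mul _ _ he, edgeMap_cornerSwap, hτf _ hv]
      exact hτs.isGridIso.valid hv
    -- The transposition repairs the outgoing edges but exchanges the first pair; the corner
    -- exchange then restores that pair.
    refine (H.mul_mem_cancel_left hτ).1 ((H.mul_mem_cancel_left hc).1 (mem_of_fixes_square hm hn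
      ht hl ((hσ.trans hτs).trans (respectsSquares_cornerSwap hm hn)) ?_ ?_ ?_ ?_))
    · rw [key (ver 0 0) ⟨Nat.zero_le _, hn⟩, h1, GridEdge.flip, Equiv.swap_apply_left]
    · rw [key (hor 0 0) ⟨hm, Nat.zero_le _⟩, h2, GridEdge.flip, Equiv.swap_apply_right]
    · rw [key (ver 1 0) ⟨hm, hn⟩, h3, GridEdge.flip, Equiv.swap_apply_of_ne_of_ne (by simp) (by simp)]
    · rw [key (hor 0 1) ⟨hm, hn⟩, h4, GridEdge.flip, Equiv.swap_apply_of_ne_of_ne (by simp) (by simp)]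

theorem mem_of_preserves_in (ht : apexSwap m n ∈ H) (hl : lastSwap hm hn ∈ H)
    (hc : cornerSwap hm hn ∈ H)
    (hf : m = n → ∃ τ ∈ H, RespectsSquares τ ∧ ∀ e : GridEdge, e.Valid m n → edgeMap τ e = e.flip)
    {σ : Equiv.Perm (Edges m n)} (hσ : RespectsSquares σ)
    (h : (edgeMap σ (ver 0 0) = ver 0 0 ∧ edgeMap σ (hor 0 0) = hor 0 0) ∨
      (edgeMap σ (ver 0 0) = hor 0 0 ∧ edgeMap σ (hor 0 0) = ver 0 0)) : σ ∈ H := by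
  rcases h with ⟨h1, h2⟩ | ⟨h1, h2⟩
  · exact mem_of_fixes_in hm hn ht hl hc hf hσ h1 h2
  · have vv : (ver 0 0).Valid m n := ⟨Nat.zero_le _, hn⟩
    have vh : (hor 0 0).Valid m n := ⟨hm, Nat.zero_le _⟩
    refine (H.mul_mem_cancel_left hc).1 (mem_of_fixes_in hm hn ht hl hc hf
      (hσ.trans (respectsSquares_cornerSwap hm hn)) ?_ ?_)
    · rw [edgeMap_mul _ _ vv, h1, edgeMap_cornerSwap hm hn vh, Equiv.swap_apply_left]
    · rw [edgeMap_mul _ _ vh, h2, edgeMap_cornerSwap hm hn vv, Equiv.swap_apply_right]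

/-- A subgroup containing the obvious symmetries contains all bijections respecting squares. -/
theorem mem_of_respectsSquares (ht : apexSwap m n ∈ H) (hr : rotPerm m n ∈ H)
    (hc : cornerSwap hm hn ∈ H)
    (hf : m = n → ∃ τ ∈ H, RespectsSquares τ ∧ ∀ e : GridEdge, e.Valid m n → edgeMap τ e = e.flip)
    {σ : Equiv.Perm (Edges m n)} (hσ : RespectsSquares σ) : σ ∈ H := by
  have hl : lastSwap hm hn ∈ H := by
    rw [← rotPerm_conj_cornerSwap]
    exact mul_mem (mul_mem hr hc) hr
  have vv : (ver 0 0).Valid m n := ⟨Nat.zero_le _, hn⟩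
  have vh : (hor 0 0).Valid m n := ⟨hm, Nat.zero_le _⟩
  have vv' : (ver m (n - 1)).Valid m n := ⟨le_rfl, by omega⟩
  have vh' : (hor (m - 1) n).Valid m n := ⟨by omega, le_rfl⟩
  have hrot : ∀ e : GridEdge, e.Valid m n → edgeMap (rotPerm m n) e = e.rot m n :=
    fun e he => edgeMap_of_valid _ he
  have rv : edgeMap (rotPerm m n) (ver m (n - 1)) = ver 0 0 := by
    rw [hrot _ vv', GridEdge.rot, Nat.sub_self, Nat.sub_self]
  have rh : edgeMap (rotPerm m n) (hor (m - 1) n) = hor 0 0 := by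
    rw [hrot _ vh', GridEdge.rot, Nat.sub_self, Nat.sub_self]
  rcases hσ.isGridIso.first_pair hm hn with h | h | ⟨h1, h2⟩ | ⟨h1, h2⟩
  · exact mem_of_preserves_in hm hn ht hl hc hf hσ (Or.inl h)
  · exact mem_of_preserves_in hm hn ht hl hc hf hσ (Or.inr h)
  · refine (H.mul_mem_cancel_left hr).1 (mem_of_preserves_in hm hn ht hl hc hf
      (hσ.trans respectsSquares_rotPerm) (Or.inl ⟨?_, ?_⟩))
    · rw [edgeMap_mul _ _ vv, h1, rv]
    · rw [edgeMap_mul _ _ vh, h2, rh]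
  · refine (H.mul_mem_cancel_left hr).1 (mem_of_preserves_in hm hn ht hl hc hf
      (hσ.trans respectsSquares_rotPerm) (Or.inr ⟨?_, ?_⟩))
    · rw [edgeMap_mul _ _ vv, h1, rh]
    · rw [edgeMap_mul _ _ vh, h2, rv]

end Automorphisms

/-! ### Homomorphisms from dihedral and cyclic groups -/

section Homs

variable {G : Type*} [Group G]

/-- The homomorphism from a finite cyclic group given by an element `a` with `a ^ n = 1`. -/
def zmodPowHom {n : ℕ} [NeZero n] (a : G) (ha : a ^ n = 1) : Multiplicative (ZMod n) →* G where
  toFun z := a ^ z.toAdd.val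
  map_one' := by simp
  map_mul' x y := by
    rw [toAdd_mul, ZMod.val_add, ← pow_add, ← pow_eq_pow_mod _ ha]

theorem zmodPowHom_apply {n : ℕ} [NeZero n] (a : G) (ha : a ^ n = 1) (z) :
    zmodPowHom a ha z = a ^ z.toAdd.val := rfl

/-- The homomorphism from a dihedral group given by elements satisfying its relations. -/
def dihedralHom {n : ℕ} [NeZero n] (a b : G) (ha : a ^ n = 1) (hb : b * b = 1)
    (hab : b * a * b = a⁻¹) : DihedralGroup n →* G where
  toFun
    | .r i => zmodPowHom a ha (.ofAdd i)
    | .sr i => b * zmodPowHom a ha (.ofAdd i)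
  map_one' := map_one (zmodPowHom a ha)
  map_mul' x y := by
    have hb' : b⁻¹ = b := inv_eq_of_mul_eq_one_left hb
    -- Conjugation by the involution `b` inverts every power of `a`.
    have hconj : ∀ i, zmodPowHom a ha i * b = b * (zmodPowHom a ha i)⁻¹ := fun i => by
      rw [zmodPowHom_apply, ← inv_pow, ← hab]
      have : b * a * b = b * a * b⁻¹ := by rw [hb']
      rw [this, conj_pow, hb', ← mul_assoc, ← mul_assoc, hb, one_mul]
    rcases x with i | i <;> rcases y with j | j
    · exact map_mul (zmodPowHom a ha) (.ofAdd i) (.ofAdd j)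
    · change b * zmodPowHom a ha (.ofAdd j / .ofAdd i) = _
      rw [div_eq_inv_mul, map_mul, map_inv, ← mul_assoc, ← mul_assoc, hconj]
    · change b * zmodPowHom a ha (.ofAdd i * .ofAdd j) = _
      rw [map_mul, mul_assoc]
    · change zmodPowHom a ha (.ofAdd j / .ofAdd i) = _
      rw [div_eq_inv_mul, map_mul, map_inv]
      change _ = b * zmodPowHom a ha (.ofAdd i) * (b * zmodPowHom a ha (.ofAdd j))
      rw [mul_assoc, ← mul_assoc _ b, hconj, ← mul_assoc, ← mul_assoc, hb, one_mul]

theorem dihedralHom_r {n : ℕ} [NeZero n] (a b : G) (ha : a ^ n = 1) (hb : b * b = 1)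
    (hab : b * a * b = a⁻¹) (i : ZMod n) :
    dihedralHom a b ha hb hab (.r i) = a ^ i.val := rfl

theorem dihedralHom_sr {n : ℕ} [NeZero n] (a b : G) (ha : a ^ n = 1) (hb : b * b = 1)
    (hab : b * a * b = a⁻¹) (i : ZMod n) :
    dihedralHom a b ha hb hab (.sr i) = b * a ^ i.val := rfl

theorem dihedralHom_commute {n : ℕ} [NeZero n] {a b c : G} (ha : a ^ n = 1) (hb : b * b = 1)
    (hab : b * a * b = a⁻¹) (hac : Commute a c) (hbc : Commute b c) (d : DihedralGroup n) :
    Commute (dihedralHom a b ha hb hab d) c := by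
  rcases d with i | i
  · exact hac.pow_left _
  · exact hbc.mul_left (hac.pow_left _)

end Homs

/-! ### The automorphism group of the grid -/

section Structure

variable {m n : ℕ} (hm : 0 < m) (hn : 0 < n)

theorem apexSwap_sq : apexSwap m n ^ 2 = 1 := by
  rw [sq]; exact Equiv.swap_mul_self _ _

theorem cornerSwap_mul_self : cornerSwap hm hn * cornerSwap hm hn = 1 := Equiv.swap_mul_self _ _

theorem lastSwap_mul_self : lastSwap hm hn * lastSwap hm hn = 1 := Equiv.swap_mul_self _ _

theorem commute_swap_of_apply {X : Type*} [DecidableEq X] {σ : Equiv.Perm X} {x y : X}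
    (h : (σ x = x ∧ σ y = y) ∨ (σ x = y ∧ σ y = x)) : Commute σ (Equiv.swap x y) := by
  rw [Commute, SemiconjBy, Equiv.mul_swap_eq_swap_mul]
  rcases h with ⟨h1, h2⟩ | ⟨h1, h2⟩
  · rw [h1, h2]
  · rw [h1, h2, Equiv.swap_comm]

theorem cornerSwap_commute_apexSwap : Commute (cornerSwap hm hn) (apexSwap m n) :=
  commute_swap_of_apply (Or.inl
    ⟨Equiv.swap_apply_of_ne_of_ne (Edges.ne_of_val_ne (by simp)) (Edges.ne_of_val_ne (by simp)),
      Equiv.swap_apply_of_ne_of_ne (Edges.ne_of_val_ne (by simp)) (Edges.ne_of_val_ne (by simp))⟩)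

theorem rotPerm_commute_apexSwap : Commute (rotPerm m n) (apexSwap m n) :=
  commute_swap_of_apply (Or.inr ⟨rfl, rfl⟩)

theorem cornerSwap_apply_of_ne {e : Edges m n} (h₁ : e.1 ≠ hor 0 0) (h₂ : e.1 ≠ ver 0 0) :
    cornerSwap hm hn e = e :=
  Equiv.swap_apply_of_ne_of_ne (Edges.ne_of_val_ne h₁) (Edges.ne_of_val_ne h₂)

theorem lastSwap_commute_cornerSwap : Commute (lastSwap hm hn) (cornerSwap hm hn) :=
  commute_swap_of_apply (Or.inl
    ⟨Equiv.swap_apply_of_ne_of_ne (Edges.ne_of_val_ne (by simp; omega))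
        (Edges.ne_of_val_ne (by simp)),
      Equiv.swap_apply_of_ne_of_ne (Edges.ne_of_val_ne (by simp))
        (Edges.ne_of_val_ne (by simp; omega))⟩)

/-- The symmetry of order four generated by the half turn and the corner exchange. -/
def quarter : Equiv.Perm (Edges m n) := cornerSwap hm hn * rotPerm m n

theorem quarter_sq : quarter hm hn ^ 2 = cornerSwap hm hn * lastSwap hm hn := by
  rw [← rotPerm_conj_cornerSwap, quarter, sq]
  simp only [mul_assoc]

theorem quarter_pow_four : quarter hm hn ^ 4 = 1 := by
  rw [show 4 = 2 * 2 from rfl, pow_mul, quarter_sq, sq, mul_assoc,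
    ← mul_assoc (lastSwap hm hn), (lastSwap_commute_cornerSwap hm hn).eq, mul_assoc,
    lastSwap_mul_self, mul_one, cornerSwap_mul_self]

theorem rotPerm_conj_quarter :
    rotPerm m n * quarter hm hn * rotPerm m n = (quarter hm hn)⁻¹ := by
  rw [eq_inv_iff_mul_eq_one, quarter]
  calc rotPerm m n * (cornerSwap hm hn * rotPerm m n) * rotPerm m n *
        (cornerSwap hm hn * rotPerm m n)
      = rotPerm m n * cornerSwap hm hn * (rotPerm m n * rotPerm m n) * cornerSwap hm hn *
        rotPerm m n := by simp only [mul_assoc]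
    _ = rotPerm m n * (cornerSwap hm hn * cornerSwap hm hn) * rotPerm m n := by
        rw [rotPerm_mul_self]; simp only [mul_assoc, one_mul]
    _ = 1 := by rw [cornerSwap_mul_self, mul_one, rotPerm_mul_self]

theorem quarter_commute_apexSwap : Commute (quarter hm hn) (apexSwap m n) :=
  (cornerSwap_commute_apexSwap hm hn).mul_left rotPerm_commute_apexSwap

/-- The action of the dihedral group on the edges. -/
def dihedralAction : DihedralGroup 4 →* Equiv.Perm (Edges m n) :=
  dihedralHom (quarter hm hn) (rotPerm m n) (quarter_pow_four hm hn) rotPerm_mul_self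
    (rotPerm_conj_quarter hm hn)

/-- The action of the dihedral group and of the exchange of the two apices. -/
def smallAction : DihedralGroup 4 × Multiplicative (ZMod 2) →* Equiv.Perm (Edges m n) :=
  (dihedralAction hm hn).noncommCoprod (zmodPowHom (apexSwap m n) apexSwap_sq) fun d z =>
    (dihedralHom_commute _ _ _ (quarter_commute_apexSwap hm hn) rotPerm_commute_apexSwap d).pow_right
      z.toAdd.val

theorem smallAction_apply (d : DihedralGroup 4) (z : Multiplicative (ZMod 2)) :
    smallAction hm hn (d, z) = dihedralAction hm hn d * apexSwap m n ^ z.toAdd.val := rfl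

theorem rotPerm_mem_range : rotPerm m n ∈ (smallAction hm hn).range :=
  ⟨(.sr 0, 1), by
    rw [smallAction_apply, dihedralAction, dihedralHom_sr]
    simp⟩

theorem quarter_mem_range : quarter hm hn ∈ (smallAction hm hn).range :=
  ⟨(.r 1, 1), by
    rw [smallAction_apply, dihedralAction, dihedralHom_r, show (1 : ZMod 4).val = 1 from rfl]
    simp⟩

theorem cornerSwap_mem_range : cornerSwap hm hn ∈ (smallAction hm hn).range := by
  have : cornerSwap hm hn = quarter hm hn * rotPerm m n := by
    rw [quarter, mul_assoc, rotPerm_mul_self, mul_one]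
  rw [this]
  exact mul_mem (quarter_mem_range hm hn) (rotPerm_mem_range hm hn)

theorem apexSwap_mem_range : apexSwap m n ∈ (smallAction hm hn).range :=
  ⟨(1, .ofAdd 1), by
    rw [smallAction_apply, map_one, one_mul, toAdd_ofAdd, show (1 : ZMod 2).val = 1 from rfl,
      pow_one]⟩

/-- The first horizontal edge. -/
def firstHor : Edges m n := ⟨hor 0 0, hm, Nat.zero_le _⟩

/-- The first vertical edge. -/
def firstVer : Edges m n := ⟨ver 0 0, Nat.zero_le _, hn⟩

/-- The last horizontal edge. -/
def lastHor : Edges m n := ⟨hor (m - 1) n, Nat.sub_lt hm one_pos, le_rfl⟩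

/-- The last vertical edge. -/
def lastVer : Edges m n := ⟨ver m (n - 1), le_rfl, Nat.sub_lt hn one_pos⟩

theorem rotPerm_firstHor : rotPerm m n (firstHor hm) = lastHor hm := rfl

theorem rotPerm_firstVer : rotPerm m n (firstVer hn) = lastVer hn := rfl

theorem rotPerm_lastHor : rotPerm m n (lastHor hm) = firstHor hm :=
  (congrArg _ (rotPerm_firstHor hm)).symm.trans (DFunLike.congr_fun rotPerm_mul_self _)

theorem rotPerm_lastVer : rotPerm m n (lastVer hn) = firstVer hn :=
  (congrArg _ (rotPerm_firstVer hn)).symm.trans (DFunLike.congr_fun rotPerm_mul_self _)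

theorem quarter_firstHor : quarter hm hn (firstHor hm) = lastHor hm := by
  rw [quarter, Equiv.Perm.mul_apply, rotPerm_firstHor]
  exact cornerSwap_apply_of_ne hm hn (by simp [lastHor]; omega) (by simp [lastHor])

theorem quarter_firstVer : quarter hm hn (firstVer hn) = lastVer hn := by
  rw [quarter, Equiv.Perm.mul_apply, rotPerm_firstVer]
  exact cornerSwap_apply_of_ne hm hn (by simp [lastVer]) (by simp [lastVer]; omega)

theorem quarter_lastHor : quarter hm hn (lastHor hm) = firstVer hn := by
  rw [quarter, Equiv.Perm.mul_apply, rotPerm_lastHor]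
  exact Equiv.swap_apply_left _ _

theorem quarter_lastVer : quarter hm hn (lastVer hn) = firstHor hm := by
  rw [quarter, Equiv.Perm.mul_apply, rotPerm_lastVer]
  exact Equiv.swap_apply_right _ _

theorem apexSwap_pow_apply {e : Edges m n} (h₁ : e.1 ≠ bot) (h₂ : e.1 ≠ top) (j : ℕ) :
    (apexSwap m n ^ j) e = e := by
  have h : apexSwap m n e = e :=
    Equiv.swap_apply_of_ne_of_ne (Edges.ne_of_val_ne h₁) (Edges.ne_of_val_ne h₂)
  induction j with
  | zero => rfl
  | succ j ih => rw [pow_succ, Equiv.Perm.mul_apply, h, ih]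

include hm hn in
theorem corner_edges_ne : (firstHor hm : Edges m n) ≠ firstVer hn ∧
    (firstHor hm : Edges m n) ≠ lastHor hm ∧ (firstHor hm : Edges m n) ≠ lastVer hn ∧
    (firstVer hn : Edges m n) ≠ lastHor hm ∧ (firstVer hn : Edges m n) ≠ lastVer hn ∧
    (lastHor hm : Edges m n) ≠ lastVer hn := by
  refine ⟨?_, ?_, ?_, ?_, ?_, ?_⟩ <;> apply Edges.ne_of_val_ne <;>
    simp [firstHor, firstVer, lastHor, lastVer] <;> omega

/-- `quarter` cycles the corner edges as `firstHor`, `lastHor`, `firstVer`, `lastVer`, so `D₄` acts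
on them as on the vertices of a square. A symmetry fixing two adjacent vertices is trivial. -/
theorem dihedralAction_eq (d : DihedralGroup 4)
    (h₁ : dihedralAction hm hn d (firstHor hm) = firstHor hm)
    (h₂ : dihedralAction hm hn d (lastHor hm) = lastHor hm) : d = 1 := by
  obtain ⟨n1, n2, n3, n4, n5, n6⟩ := corner_edges_ne hm hn
  rcases d with i | i
  · rw [dihedralAction, dihedralHom_r] at h₁
    have hi := i.val_lt
    have hv : i.val = 0 := by
      interval_cases i.val
      · rfl
      all_goals
        simp [pow_succ, quarter_firstHor, quarter_firstVer, quarter_lastHor] at h₁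
        grind
    rw [(ZMod.val_eq_zero i).1 hv]
    rfl
  · exfalso
    rw [dihedralAction, dihedralHom_sr] at h₁ h₂
    have hi := i.val_lt
    interval_cases i.val <;>
    · simp [pow_succ, quarter_firstHor, quarter_firstVer, quarter_lastHor, quarter_lastVer,
        rotPerm_firstHor, rotPerm_firstVer, rotPerm_lastHor, rotPerm_lastVer] at h₁ h₂
      grind

theorem zmod_two_eq_zero_or_one (z : Multiplicative (ZMod 2)) : z = 1 ∨ z = .ofAdd 1 := by
  revert z; decide

theorem smallAction_injective : Function.Injective (smallAction hm hn) := by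
  rw [injective_iff_map_eq_one]
  rintro ⟨d, z⟩ h
  rw [smallAction_apply] at h
  have hd : d = 1 := by
    refine dihedralAction_eq hm hn d ?_ ?_
    · have := DFunLike.congr_fun h (firstHor hm)
      rwa [Equiv.Perm.mul_apply, apexSwap_pow_apply (by simp [firstHor]) (by simp [firstHor])]
        at this
    · have := DFunLike.congr_fun h (lastHor hm)
      rwa [Equiv.Perm.mul_apply, apexSwap_pow_apply (by simp [lastHor]) (by simp [lastHor])]
        at this
  subst hd
  rcases zmod_two_eq_zero_or_one z with rfl | rfl
  · rfl
  · exfalso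
    rw [map_one, one_mul, toAdd_ofAdd, show (1 : ZMod 2).val = 1 from rfl, pow_one] at h
    have := DFunLike.congr_fun h ⟨bot, trivial⟩
    rw [apexSwap, Equiv.swap_apply_left] at this
    exact absurd (congrArg Subtype.val this) (by simp)

end Structure

/-! ### Square grids -/

section Square

variable {m : ℕ} (hm : 0 < m)

theorem flipEquiv_sq : (flipEquiv m m : Equiv.Perm (Edges m m)) ^ 2 = 1 := by
  rw [sq]
  exact Equiv.ext fun e => Subtype.ext (GridEdge.flip_flip e.1)

theorem cornerSwap_commute_flipEquiv :
    Commute (cornerSwap hm hm) (flipEquiv m m : Equiv.Perm (Edges m m)) :=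
  (commute_swap_of_apply (σ := (flipEquiv m m : Equiv.Perm (Edges m m)))
    (Or.inr ⟨rfl, rfl⟩)).symm

theorem rotPerm_commute_flipEquiv :
    Commute (rotPerm m m) (flipEquiv m m : Equiv.Perm (Edges m m)) := by
  refine Equiv.ext fun e => Subtype.ext ?_
  obtain ⟨e, he⟩ := e
  cases e <;> rfl

theorem apexSwap_commute_flipEquiv :
    Commute (apexSwap m m) (flipEquiv m m : Equiv.Perm (Edges m m)) :=
  (commute_swap_of_apply (σ := (flipEquiv m m : Equiv.Perm (Edges m m)))
    (Or.inr ⟨rfl, rfl⟩)).symm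

theorem smallAction_commute_flipEquiv (p : DihedralGroup 4 × Multiplicative (ZMod 2)) :
    Commute (smallAction hm hm p) (flipEquiv m m : Equiv.Perm (Edges m m)) :=
  (dihedralHom_commute _ _ _ ((cornerSwap_commute_flipEquiv hm).mul_left rotPerm_commute_flipEquiv)
    rotPerm_commute_flipEquiv p.1).mul_left (apexSwap_commute_flipEquiv.pow_left _)

/-- The action on the edges of a square grid, including the exchange of coordinates. -/
def squareAction : (DihedralGroup 4 × Multiplicative (ZMod 2)) × Multiplicative (ZMod 2) →*
    Equiv.Perm (Edges m m) :=
  (smallAction hm hm).noncommCoprod (zmodPowHom (flipEquiv m m) flipEquiv_sq) fun p z =>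
    (smallAction_commute_flipEquiv hm p).pow_right z.toAdd.val

theorem squareAction_apply (p : DihedralGroup 4 × Multiplicative (ZMod 2))
    (z : Multiplicative (ZMod 2)) : squareAction hm (p, z) =
      smallAction hm hm p * (flipEquiv m m : Equiv.Perm (Edges m m)) ^ z.toAdd.val := rfl

/-- On the corner edges the transposition acts as the central rotation `r 2`, so a relation
involving it forces `d = r 2`. For `m ≥ 2` the edges `hor 0 1` and `ver 1 0` distinguish the two:
the transposition exchanges them, while `r 2` fixes `ver 1 0`. -/
theorem squareAction_injective (hm2 : 2 ≤ m) : Function.Injective (squareAction hm) := by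
  rw [injective_iff_map_eq_one]
  rintro ⟨⟨d, z⟩, w⟩ h
  rw [squareAction_apply] at h
  rcases zmod_two_eq_zero_or_one w with rfl | rfl
  · rw [toAdd_one, ZMod.val_zero, pow_zero, mul_one] at h
    rw [smallAction_injective hm hm (h.trans (map_one _).symm)]
    rfl
  · exfalso
    rw [toAdd_ofAdd, show (1 : ZMod 2).val = 1 from rfl, pow_one, smallAction_apply] at h
    have happ : ∀ e : Edges m m, (flipEquiv m m e).1 ≠ bot → (flipEquiv m m e).1 ≠ top →
        dihedralAction hm hm d (flipEquiv m m e) = e := fun e h1 h2 => by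
      have := DFunLike.congr_fun h e
      rwa [Equiv.Perm.mul_apply, Equiv.Perm.mul_apply, apexSwap_pow_apply h1 h2] at this
    have hr2 : dihedralAction hm hm (.r 2) = quarter hm hm ^ 2 := by
      rw [dihedralAction, dihedralHom_r]
      rfl
    have hd : d * .r 2 = 1 := by
      refine dihedralAction_eq hm hm _ ?_ ?_
      · rw [map_mul, hr2, sq, Equiv.Perm.mul_apply, Equiv.Perm.mul_apply, quarter_firstHor,
          quarter_lastHor]
        exact happ (firstHor hm) (fun h => nomatch h) (fun h => nomatch h)
      · rw [map_mul, hr2, sq, Equiv.Perm.mul_apply, Equiv.Perm.mul_apply, quarter_lastHor,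
          quarter_firstVer]
        exact happ (lastHor hm) (fun h => nomatch h) (fun h => nomatch h)
    have hd2 : d = .r 2 := by
      rw [eq_inv_of_mul_eq_one_left hd]
      decide
    subst hd2
    have := happ ⟨hor 0 1, hm, hm⟩ (fun h => nomatch h) (fun h => nomatch h)
    have hfix : ∀ e : Edges m m, e.1 = ver 1 0 →
        (cornerSwap hm hm * lastSwap hm hm) e = e := fun e he => by
      have hl : lastSwap hm hm e = e :=
        Equiv.swap_apply_of_ne_of_ne (Edges.ne_of_val_ne (by simp [he]))
          (Edges.ne_of_val_ne (by simp [he]; omega))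
      rw [Equiv.Perm.mul_apply, hl]
      exact cornerSwap_apply_of_ne hm hm (by simp [he]) (by simp [he])
    rw [hr2, quarter_sq, hfix _ rfl] at this
    exact absurd (congrArg Subtype.val this) (fun h => nomatch h)

end Square

/-! ### Identification of the automorphism group -/

section Main

variable {m n : ℕ} (hm : 0 < m) (hn : 0 < n)

theorem smallAction_range_le :
    (smallAction hm hn).range ≤ (isIrredundant_gridIneq m n).facetHom.range := by
  rintro _ ⟨⟨d, z⟩, rfl⟩
  have hq : quarter hm hn ∈ (isIrredundant_gridIneq m n).facetHom.range :=
    mul_mem (cornerSwap_mem hm hn) rotPerm_mem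
  refine mul_mem (b := apexSwap m n ^ _) ?_ (pow_mem apexSwap_mem _)
  rcases d with i | i
  · exact pow_mem hq _
  · exact mul_mem rotPerm_mem (pow_mem hq _)

/-- In a single square every grid edge is a corner edge, so the transposition adds nothing new. This
is the exceptional case `a₁ = a₂ = 2`. -/
theorem flipEquiv_one : (flipEquiv 1 1 : Equiv.Perm (Edges 1 1)) =
    cornerSwap one_pos one_pos * lastSwap one_pos one_pos * apexSwap 1 1 := by
  refine perm_ext_edgeMap fun e he => ?_
  have hv : ∀ (σ : Equiv.Perm (Edges 1 1)) {e : GridEdge}, e.Valid 1 1 →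
      (edgeMap σ e).Valid 1 1 := fun σ e he => by
    rw [edgeMap_of_valid σ he]
    exact (σ _).2
  rw [edgeMap_mul _ _ he, edgeMap_mul _ _ (hv _ he), edgeMap_cornerSwap _ _ (hv _ (hv _ he)),
    lastSwap, edgeMap_swap _ _ (hv _ he), apexSwap, edgeMap_swap _ _ he, edgeMap_flipEquiv he]
  cases e with
  | bot => decide
  | top => decide
  | hor i k =>
    obtain ⟨hi, hk⟩ := he
    interval_cases i
    interval_cases k <;> decide
  | ver i k =>
    obtain ⟨hi, hk⟩ := he
    interval_cases k
    interval_cases i <;> decide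

theorem facetHom_range_eq_small (hmn : m = n → m = 1) :
    (isIrredundant_gridIneq m n).facetHom.range = (smallAction hm hn).range := by
  refine le_antisymm (fun σ hσ => ?_) (smallAction_range_le hm hn)
  refine mem_of_respectsSquares hm hn (apexSwap_mem_range hm hn) (rotPerm_mem_range hm hn)
    (cornerSwap_mem_range hm hn) (fun h => ?_) (respectsSquares_of_mem hσ)
  obtain rfl := hmn h
  subst h
  refine ⟨flipEquiv 1 1, ?_, respectsSquares_flipEquiv, fun e he => edgeMap_flipEquiv he⟩
  rw [flipEquiv_one, ← rotPerm_conj_cornerSwap]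
  exact mul_mem (mul_mem (cornerSwap_mem_range hm hn) (mul_mem (mul_mem (rotPerm_mem_range hm hn)
    (cornerSwap_mem_range hm hn)) (rotPerm_mem_range hm hn))) (apexSwap_mem_range hm hn)

theorem facetHom_range_eq_square :
    (isIrredundant_gridIneq m m).facetHom.range = (squareAction hm).range := by
  have hle : (smallAction hm hm).range ≤ (squareAction hm).range := by
    rintro _ ⟨p, rfl⟩
    refine ⟨(p, 1), ?_⟩
    rw [squareAction_apply, toAdd_one, ZMod.val_zero, pow_zero, mul_one]
  apply le_antisymm
  · intro σ hσ
    refine mem_of_respectsSquares hm hm (hle (apexSwap_mem_range hm hm))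
      (hle (rotPerm_mem_range hm hm)) (hle (cornerSwap_mem_range hm hm))
      (fun _ => ⟨flipEquiv m m, ⟨(1, .ofAdd 1), ?_⟩, respectsSquares_flipEquiv,
        fun e he => edgeMap_flipEquiv he⟩) (respectsSquares_of_mem hσ)
    rw [squareAction_apply, map_one, one_mul, toAdd_ofAdd, show (1 : ZMod 2).val = 1 from rfl,
      pow_one]
  · rintro _ ⟨⟨p, z⟩, rfl⟩
    exact mul_mem (smallAction_range_le hm hm ⟨p, rfl⟩) (pow_mem flipEquiv_mem _)

/-- A group acting faithfully on the edges with the right image is the automorphism group. -/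
noncomputable def combAutEquivOfRange {G : Type*} [Group G] (Φ : G →* Equiv.Perm (Edges m n))
    (hΦ : Function.Injective Φ)
    (hrange : (isIrredundant_gridIneq m n).facetHom.range = Φ.range) :
    CombAut (GTPolytope (twoPartPartition (m + 1) (n + 1))) ≃* G :=
  (combAutGTEquiv m n).trans <|
    (MonoidHom.ofInjective (isIrredundant_gridIneq m n).facetHom_injective).trans <|
      (MulEquiv.subgroupCongr hrange).trans (MonoidHom.ofInjective hΦ).symm

end Main

theorem theorem1p2 (a₁ a₂ : ℕ) (h₁ : 2 ≤ a₁) (h₂ : 2 ≤ a₂) :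
    ((a₁ = 2 ∧ a₂ = 2) →
      Nonempty (CombAut (GTPolytope (twoPartPartition a₁ a₂)) ≃*
        DihedralGroup 4 × Multiplicative (ZMod 2))) ∧
    (¬ (a₁ = 2 ∧ a₂ = 2) →
      Nonempty (CombAut (GTPolytope (twoPartPartition a₁ a₂)) ≃*
        DihedralGroup 4 × Multiplicative (ZMod 2) ×
          (Fin (if a₁ = a₂ then 1 else 0) → Multiplicative (ZMod 2)))) := by
  -- Here `m` and `n` count unit squares; `a₁, a₂ ≥ 2` ensures that there is at least one.
  obtain ⟨m, rfl⟩ : ∃ m, a₁ = m + 1 := ⟨a₁ - 1, by omega⟩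
  obtain ⟨n, rfl⟩ : ∃ n, a₂ = n + 1 := ⟨a₂ - 1, by omega⟩
  have hm : 0 < m := by omega
  have hn : 0 < n := by omega
  have small : (m = n → m = 1) →
      Nonempty (CombAut (GTPolytope (twoPartPartition (m + 1) (n + 1))) ≃*
        DihedralGroup 4 × Multiplicative (ZMod 2)) := fun h =>
    ⟨combAutEquivOfRange _ (smallAction_injective hm hn) (facetHom_range_eq_small hm hn h)⟩
  refine ⟨fun h => small (by omega), fun h => ?_⟩
  by_cases hmn : m = n
  · subst hmn
    rw [if_pos rfl]
    exact ⟨((combAutEquivOfRange _ (squareAction_injective hm (by omega))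
      (facetHom_range_eq_square hm)).trans MulEquiv.prodAssoc).trans
        ((MulEquiv.refl _).prodCongr ((MulEquiv.refl _).prodCongr
          (MulEquiv.funUnique (Fin 1) (Multiplicative (ZMod 2))).symm))⟩
  · rw [if_neg (by omega)]
    obtain ⟨φ⟩ := small (fun h => absurd h hmn)
    exact ⟨φ.trans ((MulEquiv.refl _).prodCongr MulEquiv.prodUnique.symm)⟩
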